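/- Let $V=(V,Y,\mathbf 1,\omega)$ be a vertex operator algebra over $\mathbb C$ (with $V=\bigoplus_{k\in\mathbb Z}V_k$, $\dim V_k<\infty$, $V_k=0$ for $k\ll0$), let $L(k)=\omega_{k+1}$, and let $m,n$ be nonnegative integers. For $p,m,n\in\mathbb Z_{\ge 0}$, homogeneous $u\in V$ and $v\in V$ put $$u\ast_{m,p}^{n}v=\sum_{i=0}^{p}(-1)^{i}\binom{m+n-p+i}{i}\,\mathrm{Res}_{z}\frac{(1+z)^{\mathrm{wt}\,u+m}}{z^{m+n-p+i+1}}Y(u,z)v,\qquad u\circ_m^n v=\mathrm{Res}_z\frac{(1+z)^{\mathrm{wt}\,u+m}}{z^{n+m+2}}Y(u,z)v,$$ extended linearly in $u$, where $\binom{x}{i}=x(x-1)\cdots(x-i+1)/i!$ for all $x\in\mathbb Z$. Write $\bar\ast_m^n=\ast_{m,n}^n$, $\ast_m^n=\ast_{m,m}^n$, $\ast_n=\ast_{n,n}^n$. Let - $O'_{n,m}(V)$ be the linear span of all $u\circ_m^n v$ and all $L(-1)u+(L(0)+m-n)u$, and $O_n(V)=O'_{n,n}(V)$; - $O''_{n,m}(V)$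 be the linear span of all $u\ast_{m,p_3}^n\big((a\ast_{p_1,p_2}^{p_3}b)\ast_{m,p_1}^{p_3}c-a\ast_{m,p_2}^{p_3}(b\ast_{m,p_1}^{p_2}c)\big)$ with $a,b,c,u\in V$, $p_1,p_2,p_3\in\mathbb Z_{\ge0}$; - $O'''_{n,m}(V)=\sum_{p\ge0}(V\ast_p^nO_p(V))\ast_{m,p}^nV$ (linear span of the products); - $O_{n,m}(V)=O'_{n,m}(V)+O''_{n,m}(V)+O'''_{n,m}(V)$, $\;A_n(V)=V/O_n(V)$, $\;A_{n,m}(V)=V/O_{n,m}(V)$. Let $\phi:V\to V$, $\phi(v)=e^{L(1)}(-1)^{L(0)}v$. Then: 1. for every $k\ge 0$, $A_k(V)$ is a unital associative algebra under the product induced by $\ast_k$, with identity $\mathbf 1+O_k(V)$; 2. $A_{n,m}(V)$ is an $A_n(V)$-$A_m(V)$-bimodule with left action induced by $u\,\bar\ast_m^n\,v$ and right action induced by $u\ast_m^n v$; 3. $A_{m,n}(V)$ is an $A_n(V)$-$A_m(V)$-bimodule with the left action of $A_n(V)$ induced by $u\,\bar\cdot_m^n\,v=v\ast_n^m\phi(u)$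 and the right action of $A_m(V)$ induced by $u\cdot_m^n v=\phi(v)\,\bar\ast_n^m\,u$; 4. $\phi$ induces an isomorphism of $A_n(V)$-$A_m(V)$-bimodules from $A_{n,m}(V)$, with the structure in 2, to $A_{m,n}(V)$, with the structure in 3. -/

import Mathlib

noncomputable section

namespace VertexOperatorAlgebra

/-- The mode `u_k` of the vertex operator `Y(u,z) = ∑ u_k z^{-k-1}`. -/
abbrev modeOf {V : Type*} [AddCommGroup V] [Module ℂ V]
    (Y : V →ₗ[ℂ] VertexOperator ℂ V) (u : V) (k : ℤ) : Module.End ℂ V :=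
  VertexOperator.ncoeff (Y u) k

end VertexOperatorAlgebra

open VertexOperatorAlgebra in
/-- A vertex operator algebra structure `(V, Y, 𝟏, ω)` on a complex vector space `V`.
That `Y(u,z)v` has only finitely many negative powers of `z` is part of Mathlib's `VertexOperator`
(it is a Laurent series), so all the sums `∑ᶠ` below are finite. -/
structure VertexOperatorAlgebra (V : Type*) [AddCommGroup V] [Module ℂ V] where
  /-- the state-field correspondence -/
  Y : V →ₗ[ℂ] VertexOperator ℂ V
  /-- the vacuum vector -/
  vacuum : V
  /-- the conformal (Virasoro) vector -/
  omega : V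
  /-- the central charge -/
  centralCharge : ℂ
  /-- the homogeneous subspaces `V_k` -/
  wt : ℤ → Submodule ℂ V
  /-- `V` is the direct sum of the `V_k` -/
  decomposition : DirectSum.Decomposition wt
  finiteDimensional_wt : ∀ k, FiniteDimensional ℂ (wt k)
  wt_eq_bot : ∃ N : ℤ, ∀ k < N, wt k = ⊥
  vacuum_mem : vacuum ∈ wt 0
  omega_mem : omega ∈ wt 2
  /-- `Y(𝟏,z) = id` -/
  vacuum_mode : ∀ (k : ℤ) (v : V), modeOf Y vacuum k v = if k = -1 then v else 0
  /-- `Y(u,z)𝟏` is a power series in `z` ... -/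
  mode_vacuum_nonneg : ∀ (u : V) (k : ℤ), 0 ≤ k → modeOf Y u k vacuum = 0
  /-- ... with constant term `u` -/
  mode_vacuum_neg_one : ∀ u : V, modeOf Y u (-1) vacuum = u
  /-- the Jacobi identity, in components -/
  jacobi : ∀ (u v w : V) (l p q : ℤ),
    ∑ᶠ i : ℕ, Ring.choose p i • modeOf Y (modeOf Y u (l + i) v) (p + q - i) w =
      ∑ᶠ i : ℕ, ((-1 : ℤ) ^ i * Ring.choose l i) •
        (modeOf Y u (p + l - i) (modeOf Y v (q + i) w)
          - (-1 : ℂ) ^ l • modeOf Y v (q + l - i) (modeOf Y u (p + i) w))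
  /-- the Virasoro relations for `L(k) = ω_{k+1}` -/
  virasoro : ∀ (j k : ℤ) (v : V),
    modeOf Y omega (j + 1) (modeOf Y omega (k + 1) v)
        - modeOf Y omega (k + 1) (modeOf Y omega (j + 1) v) =
      ((j : ℂ) - k) • modeOf Y omega (j + k + 1) v
        + (if j + k = 0 then ((j : ℂ) ^ 3 - j) / 12 * centralCharge else 0) • v
  /-- `L(0)` acts on `V_k` as multiplication by `k` -/
  L_zero : ∀ (k : ℤ), ∀ v ∈ wt k, modeOf Y omega 1 v = (k : ℂ) • v
  /-- `Y(L(-1)u,z) = d/dz Y(u,z)` -/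
  L_neg_one : ∀ (u v : V) (k : ℤ),
    modeOf Y (modeOf Y omega 0 u) k v = (-k : ℂ) • modeOf Y u (k - 1) v

namespace VertexOperatorAlgebra

/-- `u_k`, where `Y(u,z) = ∑ u_k z^{-k-1}` -/
def mode {V : Type*} [AddCommGroup V] [Module ℂ V] (A : VertexOperatorAlgebra V)
    (u : V) (k : ℤ) : Module.End ℂ V :=
  modeOf A.Y u k

/-- `L(k) = ω_{k+1}` -/
def L {V : Type*} [AddCommGroup V] [Module ℂ V] (A : VertexOperatorAlgebra V)
    (k : ℤ) : Module.End ℂ V :=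
  A.mode A.omega (k + 1)

/-- the component in `V_k` of a vector -/
def component {V : Type*} [AddCommGroup V] [Module ℂ V] (A : VertexOperatorAlgebra V)
    (k : ℤ) (v : V) : V :=
  letI := A.decomposition
  (DirectSum.decompose A.wt v k : V)

/-- `Res_z (1+z)^a z^{-b} Y(u,z)v`, with `(1+z)^a` expanded in nonnegative powers of `z` -/
def res {V : Type*} [AddCommGroup V] [Module ℂ V] (A : VertexOperatorAlgebra V)
    (a b : ℤ) (u v : V) : V :=
  ∑ᶠ j : ℕ, Ring.choose a j • A.mode u (j - b) v

/-- The product `u ∗_{m,p}^n v`: for `u` of weight `k` it is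
`∑_{i=0}^p (-1)^i (m+n-p+i choose i) Res_z (1+z)^{k+m} z^{-(m+n-p+i+1)} Y(u,z)v`,
and it is extended linearly to all `u`. The binomial coefficient with a possibly negative upper
entry is the polynomial one. -/
def starProd {V : Type*} [AddCommGroup V] [Module ℂ V] (A : VertexOperatorAlgebra V)
    (m p n : ℕ) (u v : V) : V :=
  ∑ᶠ k : ℤ, ∑ i ∈ Finset.range (p + 1),
    ((-1 : ℤ) ^ i * Ring.choose ((m : ℤ) + n - p + i) i) •
      A.res (k + m) ((m : ℤ) + n - p + i + 1) (A.component k u) v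

/-- `u ∗̄_m^n v = u ∗_{m,n}^n v` -/
def starLeft {V : Type*} [AddCommGroup V] [Module ℂ V] (A : VertexOperatorAlgebra V)
    (m n : ℕ) (u v : V) : V :=
  A.starProd m n n u v

/-- `u ∗_m^n v = u ∗_{m,m}^n v` -/
def starRight {V : Type*} [AddCommGroup V] [Module ℂ V] (A : VertexOperatorAlgebra V)
    (m n : ℕ) (u v : V) : V :=
  A.starProd m m n u v

/-- `O'_{n,m}(V)`: the linear span of the `u ∘_m^n v = Res_z (1+z)^{wt u+m} z^{-(n+m+2)} Y(u,z)v`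
(`u` homogeneous) and the `L(-1)u + (L(0)+m-n)u` -/
def O' {V : Type*} [AddCommGroup V] [Module ℂ V] (A : VertexOperatorAlgebra V)
    (n m : ℕ) : Submodule ℂ V :=
  Submodule.span ℂ
    ({x | ∃ k : ℤ, ∃ u ∈ A.wt k, ∃ v : V, x = A.res (k + m) ((n : ℤ) + m + 2) u v} ∪
      {x | ∃ u : V, x = A.L (-1) u + (A.L 0 u + ((m : ℂ) - n) • u)})

/-- `O''_{n,m}(V)`: the linear span of the
`u ∗_{m,p₃}^n ((a ∗_{p₁,p₂}^{p₃} b) ∗_{m,p₁}^{p₃} c - a ∗_{m,p₂}^{p₃} (b ∗_{m,p₁}^{p₂} c))` -/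
def O'' {V : Type*} [AddCommGroup V] [Module ℂ V] (A : VertexOperatorAlgebra V)
    (n m : ℕ) : Submodule ℂ V :=
  Submodule.span ℂ {x | ∃ (a b c u : V) (p₁ p₂ p₃ : ℕ),
    x = A.starProd m p₃ n u (A.starProd m p₁ p₃ (A.starProd p₁ p₂ p₃ a b) c
      - A.starProd m p₂ p₃ a (A.starProd m p₁ p₂ b c))}

/-- `O'''_{n,m}(V) = ∑_p (V ∗_p^n O_p(V)) ∗_{m,p}^n V`, where `O_p(V) = O'_{p,p}(V)` -/
def O''' {V : Type*} [AddCommGroup V] [Module ℂ V] (A : VertexOperatorAlgebra V)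
    (n m : ℕ) : Submodule ℂ V :=
  Submodule.span ℂ {x | ∃ (p : ℕ) (u w v : V), w ∈ A.O' p p ∧
    x = A.starProd m p n (A.starRight p n u w) v}

/-- `O_{n,m}(V) = O'_{n,m}(V) + O''_{n,m}(V) + O'''_{n,m}(V)` -/
def O {V : Type*} [AddCommGroup V] [Module ℂ V] (A : VertexOperatorAlgebra V)
    (n m : ℕ) : Submodule ℂ V :=
  A.O' n m ⊔ A.O'' n m ⊔ A.O''' n m

/-- `A_{n,m}(V) = V / O_{n,m}(V)`, as a complex vector space -/
abbrev ABimod {V : Type*} [AddCommGroup V] [Module ℂ V] (A : VertexOperatorAlgebra V)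
    (n m : ℕ) : Type _ :=
  V ⧸ A.O n m

/-- the class in `A_{n,m}(V)` of a vector -/
def toABimod {V : Type*} [AddCommGroup V] [Module ℂ V] (A : VertexOperatorAlgebra V)
    (n m : ℕ) (v : V) : A.ABimod n m :=
  Submodule.Quotient.mk v

/-- `A_n(V) = V / O_n(V)`, as a set; its algebra structure is characterized by `IsAAlg`. -/
def AAlg {V : Type*} [AddCommGroup V] [Module ℂ V] (A : VertexOperatorAlgebra V)
    (n : ℕ) : Type _ :=
  V ⧸ A.O' n n

/-- the class in `A_n(V)` of a vector -/
def toAAlg {V : Type*} [AddCommGroup V] [Module ℂ V] (A : VertexOperatorAlgebra V)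
    (n : ℕ) (v : V) : A.AAlg n :=
  Submodule.Quotient.mk (p := A.O' n n) v

/-- The given (associative, unital) algebra structure on `A_n(V)` is the one on the quotient space
`V / O_n(V)` with the product induced by `∗_n` and the identity `𝟏 + O_n(V)`. -/
structure IsAAlg {V : Type*} [AddCommGroup V] [Module ℂ V] (A : VertexOperatorAlgebra V)
    (n : ℕ) [Ring (A.AAlg n)] [Algebra ℂ (A.AAlg n)] : Prop where
  isLinearMap : IsLinearMap ℂ (A.toAAlg n)
  mul : ∀ u v : V, A.toAAlg n u * A.toAAlg n v = A.toAAlg n (A.starProd n n n u v)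
  one : (1 : A.AAlg n) = A.toAAlg n A.vacuum

/-- `(-1)^{L(0)} v = ∑_k (-1)^k v_k` -/
def negOnePowL0 {V : Type*} [AddCommGroup V] [Module ℂ V] (A : VertexOperatorAlgebra V)
    (v : V) : V :=
  ∑ᶠ k : ℤ, (-1 : ℂ) ^ k • A.component k v

/-- `e^{L(1)} v = ∑_j L(1)^j v / j!`, a finite sum since `L(1)` lowers the weight by `1` -/
def expL1 {V : Type*} [AddCommGroup V] [Module ℂ V] (A : VertexOperatorAlgebra V)
    (v : V) : V :=
  ∑ᶠ j : ℕ, ((j.factorial : ℂ)⁻¹) • (A.L 1 ^ j) v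

/-- `φ = e^{L(1)} (-1)^{L(0)}` -/
def phi {V : Type*} [AddCommGroup V] [Module ℂ V] (A : VertexOperatorAlgebra V)
    (v : V) : V :=
  A.expL1 (A.negOnePowL0 v)

end VertexOperatorAlgebra

/-- A complex vector space `M` with a left `R`-module and a right `S`-module structure (a left module
over the opposite algebra) is an `R`-`S`-bimodule: the two actions commute, and are compatible with
the complex vector space structure. -/
structure IsBimodule (R S M : Type*) [Ring R] [Algebra ℂ R] [Ring S] [Algebra ℂ S]
    [AddCommGroup M] [Module ℂ M] [Module R M] [Module Sᵐᵒᵖ M] : Prop where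
  smulCommClass : SMulCommClass R Sᵐᵒᵖ M
  isScalarTower_left : IsScalarTower ℂ R M
  isScalarTower_right : IsScalarTower ℂ Sᵐᵒᵖ M

end

/-! The decisive point is that `O''` and `O'''` add nothing: `O_eq_O'` gives O_{n,m}(V) =
O'_{n,m}(V), so every claim becomes a congruence modulo O'_{n,m}(V).

All operations are residues Res f(z)Y(u,z)v with f rational and regular away from 0, -1 and ∞. For u
of weight k such a residue lies in O'_{n,m}(V) as soon as f has order at least k+m at -1 and degree
at most k-2-n at ∞ (`residue_mem_O'`). For a product of two vertex operators a bound on the sum of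
the two degrees suffices (`residue_residue_mem_O'`). The kernel of u ∗_{m,p}^n v is (1+z)^{k+m}
times the expansion at ∞ of (1+z)^{p-n-m-1}, cut exactly where the tail becomes negligible. So it
agrees at ∞ with (1+z)^{k+p-n-1}, while keeping the prescribed order at -1.

Integrating the Jacobi identity against f(x)g(y)(x-y)^{-N} expresses (Res (1+x)^{wt a+q} x^{-N}
Y(a,x)b) ∗ c as a combination of terms a ∗ (b ∗ c) (`mkQ_star_residue`). When the pole order N is
large the combination is empty, which makes O' stable under right multiplication
(`star_mem_O'_of_left_mem`). Summing over the terms of a ∗ b leaves a single term, which is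
associativity (`star_assoc_mem_O'`). Together with `star_mem_O'_of_right_mem` and the two vacuum
identities this yields the algebras and the bimodule A_{n,m}(V).

The map φ acts on kernels by the substitution z ↦ -z/(1+z), which fixes 0 and exchanges -1 and ∞;
hence it exchanges n and m. Skew symmetry modulo O' produces the same substitution, so φ(u ∗_{m,p}^n
v) ≡ φ(v) ∗_{n,p}^m φ(u) (`mkQ_phiLinear_star`). Since φ² = 1, the twisted structure on A_{m,n}(V)
is the transport along φ of the structure on A_{n,m}(V). -/

noncomputable section

open scoped LaurentSeries
open Finset Filter

/-! ### Binomial coefficients with integral entries -/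

/-- The binomial coefficient with integral entries, zero for a negative lower entry. -/
def zchoose (a j : ℤ) : ℤ := if 0 ≤ j then Ring.choose a j.toNat else 0

theorem zchoose_of_neg (a : ℤ) {j : ℤ} (h : j < 0) : zchoose a j = 0 := by
  simp [zchoose, h]

theorem zchoose_natCast (a : ℤ) (j : ℕ) : zchoose a j = Ring.choose a j := by
  simp [zchoose]

theorem zchoose_zero_right (a : ℤ) : zchoose a 0 = 1 := by
  simp [zchoose]

theorem zchoose_zero_left {j : ℤ} (hj : j ≠ 0) : zchoose 0 j = 0 := by
  rcases lt_or_ge j 0 with h | h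
  · exact zchoose_of_neg _ h
  · lift j to ℕ using h
    rw [zchoose_natCast, Ring.choose_zero_pos]
    lia

theorem zchoose_succ (a j : ℤ) : zchoose (a + 1) j = zchoose a j + zchoose a (j - 1) := by
  rcases lt_trichotomy j 0 with h | rfl | h
  · rw [zchoose_of_neg _ h, zchoose_of_neg _ h, zchoose_of_neg _ (by lia), add_zero]
  · simp [zchoose_zero_right, zchoose_of_neg]
  · obtain ⟨k, rfl⟩ : ∃ k : ℕ, j = (k : ℤ) + 1 := ⟨(j - 1).toNat, by lia⟩
    have h1 := zchoose_natCast (a + 1) (k + 1)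
    have h2 := zchoose_natCast a (k + 1)
    push_cast at h1 h2
    rw [add_sub_cancel_right, h1, h2, zchoose_natCast, Ring.choose_succ_succ, add_comm]

/-- The absorption identity `j (a choose j) = (a - j + 1) (a choose j - 1)`. -/
theorem zchoose_absorb (a j : ℤ) : j * zchoose a j = (a - j + 1) * zchoose a (j - 1) := by
  rcases lt_trichotomy j 0 with h | rfl | h
  · rw [zchoose_of_neg _ h, zchoose_of_neg _ (by lia)]; simp
  · simp [zchoose_of_neg]
  · obtain ⟨k, rfl⟩ : ∃ k : ℕ, j = (k : ℤ) + 1 := ⟨(j - 1).toNat, by lia⟩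
    have h2 := zchoose_natCast a (k + 1)
    push_cast at h2
    rw [add_sub_cancel_right, h2, zchoose_natCast]
    have h3 := Ring.choose_smul_choose a (n := k + 1) (k := k) (by lia)
    simp only [nsmul_eq_mul, Nat.choose_succ_self_right, Nat.add_sub_cancel_left,
      Ring.choose_one_right] at h3
    push_cast at h3
    linear_combination h3

theorem choose_natCast_eq_zero {k h : ℕ} (hk : k < h) : Ring.choose (k : ℤ) h = 0 := by
  rw [Ring.choose_natCast, Nat.choose_eq_zero_of_lt hk, Nat.cast_zero]

theorem choose_mul_choose_add (a : ℤ) (j h : ℕ) :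
    Ring.choose ((j : ℤ) + h) h * Ring.choose a (j + h) =
      Ring.choose a h * Ring.choose (a - h) j := by
  have h3 := Ring.choose_smul_choose a (n := j + h) (k := h) (by lia)
  simp only [nsmul_eq_mul, Nat.add_sub_cancel] at h3
  rw [← h3, ← Nat.cast_add, Ring.choose_natCast]

theorem zchoose_vandermonde (a b : ℤ) (n : ℕ) :
    zchoose (a + b) n = ∑ i ∈ range (n + 1), zchoose a i * zchoose b (n - i) := by
  rw [zchoose_natCast, Ring.add_choose_eq n (Commute.all a b),
    Finset.Nat.sum_antidiagonal_eq_sum_range_succ_mk]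
  refine sum_congr rfl fun i hi => ?_
  have := mem_range.1 hi
  rw [zchoose_natCast, show (n : ℤ) - i = ((n - i : ℕ) : ℤ) by lia, zchoose_natCast]

instance : IsScalarTower ℂ ℂ⸨X⸩ ℂ⸨X⸩ := ⟨fun c x y => by
  change (c • x) * y = c • (x * y)
  rw [← HahnSeries.C_mul_eq_smul, ← HahnSeries.C_mul_eq_smul, mul_assoc]⟩

instance : SMulCommClass ℂ ℂ⸨X⸩ ℂ⸨X⸩ := ⟨fun c x y => by
  change c • (x * y) = x * c • y
  rw [← HahnSeries.C_mul_eq_smul, ← HahnSeries.C_mul_eq_smul, mul_left_comm]⟩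

theorem LaurentSeries.zero_smul (f : ℂ⸨X⸩) : (0 : ℂ) • f = 0 := _root_.zero_smul ℂ f

/-! ### Kernels: orders at -1 and ∞, truncated expansions at ∞ -/

/-- `(1 + z) ^ α * z ^ β` as a Laurent series in `z`. -/
def bin (α β : ℤ) : ℂ⸨X⸩ :=
  HahnSeries.single β 1 * HahnSeries.ofPowerSeries ℤ ℂ (PowerSeries.binomialSeries ℂ α)

theorem coeff_ofPowerSeries_binomialSeries (α j : ℤ) :
    (HahnSeries.ofPowerSeries ℤ ℂ (PowerSeries.binomialSeries ℂ α)).coeff j =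
      (zchoose α j : ℂ) := by
  rcases lt_or_ge j 0 with h | h
  · rw [zchoose_of_neg _ h, HahnSeries.ofPowerSeries_apply,
      HahnSeries.embDomain_of_notMem_range]
    · simp
    · rintro ⟨k, hk⟩
      have hk' : (k : ℤ) = j := hk
      lia
  · lift j to ℕ using h
    rw [HahnSeries.ofPowerSeries_apply_coeff, PowerSeries.binomialSeries_coeff, zchoose_natCast]
    simp

theorem coeff_bin (α β j : ℤ) : (bin α β).coeff j = (zchoose α (j - β) : ℂ) := by
  rw [bin, HahnSeries.coeff_single_mul, one_mul, coeff_ofPowerSeries_binomialSeries]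

theorem bin_mul_bin (α β α' β' : ℤ) : bin α β * bin α' β' = bin (α + α') (β + β') := by
  rw [bin, bin, bin, PowerSeries.binomialSeries_add, map_mul, ← one_mul (1 : ℂ),
    ← HahnSeries.single_mul_single]
  simp only [one_mul]
  ring

theorem single_eq_bin (β : ℤ) : HahnSeries.single β (1 : ℂ) = bin 0 β := by
  simp [bin]

theorem bin_zero_zero : bin 0 0 = 1 := by
  rw [← single_eq_bin]; rfl

theorem bin_succ (α β : ℤ) : bin (α + 1) β = bin α β + bin α (β + 1) := by
  ext j
  rw [HahnSeries.coeff_add, coeff_bin, coeff_bin, coeff_bin, zchoose_succ]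
  push_cast
  ring_nf

/-- The Leibniz rule. On coefficients it is Vandermonde's identity followed by
`choose_mul_choose_add`. -/
theorem hasseDeriv_bin (h : ℕ) (α β : ℤ) :
    LaurentSeries.hasseDeriv ℂ h (bin α β) = ∑ i ∈ range (h + 1),
      ((Ring.choose α i * Ring.choose β (h - i) : ℤ) : ℂ) • bin (α - i) (β - h + i) := by
  ext j
  rw [LaurentSeries.hasseDeriv_coeff, HahnSeries.coeff_sum, coeff_bin, zsmul_eq_mul]
  simp only [HahnSeries.coeff_smul, coeff_bin, smul_eq_mul]
  have key : Ring.choose (j + h) h * zchoose α (j + h - β) =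
      ∑ i ∈ range (h + 1), Ring.choose α i * Ring.choose β (h - i) *
        zchoose (α - i) (j - (β - h + i)) := by
    rcases lt_or_ge (j + h - β) 0 with hk | hk
    · rw [zchoose_of_neg _ hk, mul_zero]
      refine (sum_eq_zero fun i _ => ?_).symm
      rw [zchoose_of_neg _ (by lia), mul_zero]
    · obtain ⟨k, hk'⟩ : ∃ k : ℕ, j + h - β = k := ⟨(j + h - β).toNat, by lia⟩
      rw [hk', ← zchoose_natCast, show j + h = k + β by lia, zchoose_vandermonde, sum_mul]
      refine sum_congr rfl fun i hi => ?_
      have hi' := mem_range.1 hi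
      rw [show (h : ℤ) - i = ((h - i : ℕ) : ℤ) by lia, zchoose_natCast, zchoose_natCast,
        zchoose_natCast]
      rcases lt_or_ge k i with hki | hki
      · rw [choose_natCast_eq_zero hki, zchoose_of_neg _ (by lia)]; simp
      · obtain ⟨l, rfl⟩ := Nat.exists_eq_add_of_le' hki
        rw [show j - (β - h + i) = (l : ℤ) by push_cast at hk'; lia, zchoose_natCast]
        have := choose_mul_choose_add α l i
        push_cast
        linear_combination Ring.choose β (h - i) * this
  exact_mod_cast congrArg (Int.cast : ℤ → ℂ) key

theorem hasseDeriv_one_bin (α β : ℤ) :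
    LaurentSeries.hasseDeriv ℂ 1 (bin α β) =
      (α : ℂ) • bin (α - 1) β + (β : ℂ) • bin α (β - 1) := by
  rw [hasseDeriv_bin, sum_range_succ, sum_range_one]
  simp [add_comm]

/-- The span of the functions `(1 + z) ^ α * z ^ b` with `α + b ≤ β`: rational functions of `z`
that are regular away from `0`, `-1` and `∞`, of order at least `α` at `-1` and at most `β`
at `∞`. -/
def polarSpace (α β : ℤ) : Submodule ℂ ℂ⸨X⸩ :=
  Submodule.span ℂ {f | ∃ b : ℤ, α + b ≤ β ∧ f = bin α b}

theorem bin_mem_polarSpace {α β α' b : ℤ} (hα : α ≤ α') (hb : α' + b ≤ β) :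
    bin α' b ∈ polarSpace α β := by
  obtain ⟨k, rfl⟩ : ∃ k : ℕ, α' = α + k := ⟨(α' - α).toNat, by lia⟩
  clear hα
  induction k generalizing b with
  | zero => exact Submodule.subset_span ⟨b, by simpa using hb, by simp⟩
  | succ k ih =>
    push_cast at hb ⊢
    rw [← add_assoc, bin_succ]
    exact add_mem (ih (by lia)) (ih (by lia))

theorem polarSpace_induction {α β : ℤ} {p : ℂ⸨X⸩ → Prop} (hbin : ∀ b, α + b ≤ β → p (bin α b))
    (hzero : p 0) (hadd : ∀ f g, p f → p g → p (f + g)) (hsmul : ∀ (c : ℂ) f, p f → p (c • f))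
    {f : ℂ⸨X⸩} (hf : f ∈ polarSpace α β) : p f := by
  induction hf using Submodule.span_induction with
  | mem f hf => obtain ⟨b, hb, rfl⟩ := hf; exact hbin b hb
  | zero => exact hzero
  | add f g _ _ h1 h2 => exact hadd f g h1 h2
  | smul c f _ h => exact hsmul c f h

theorem polarSpace_mono {α β α' β' : ℤ} (hα : α ≤ α') (hβ : β' ≤ β) :
    polarSpace α' β' ≤ polarSpace α β := by
  intro f hf
  exact polarSpace_induction (fun b hb => bin_mem_polarSpace hα (hb.trans hβ)) (zero_mem _)
    (fun _ _ => add_mem) (fun c _ => Submodule.smul_mem _ c) hf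

theorem mul_mem_polarSpace {α β α' β' : ℤ} {f g : ℂ⸨X⸩} (hf : f ∈ polarSpace α β)
    (hg : g ∈ polarSpace α' β') : f * g ∈ polarSpace (α + α') (β + β') := by
  refine polarSpace_induction (p := fun f => f * g ∈ _) (fun b hb => ?_) (by simp)
    (fun f g h1 h2 => by rw [add_mul]; exact add_mem h1 h2)
    (fun c f h => by rw [smul_mul_assoc]; exact Submodule.smul_mem _ c h) hf
  refine polarSpace_induction (p := fun g => bin α b * g ∈ _) (fun b' hb' => ?_) (by simp)
    (fun f g h1 h2 => by rw [mul_add]; exact add_mem h1 h2)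
    (fun c f h => by rw [mul_smul_comm]; exact Submodule.smul_mem _ c h) hg
  rw [bin_mul_bin]
  exact bin_mem_polarSpace le_rfl (by lia)

theorem hasseDeriv_mem_polarSpace {α β : ℤ} {f : ℂ⸨X⸩} (hf : f ∈ polarSpace α β) (h : ℕ) :
    LaurentSeries.hasseDeriv ℂ h f ∈ polarSpace (α - h) (β - h) := by
  refine polarSpace_induction (p := fun f => LaurentSeries.hasseDeriv ℂ h f ∈ _)
    (fun b hb => ?_) (by simp)
    (fun f g h1 h2 => by rw [map_add]; exact add_mem h1 h2)
    (fun c f h => by rw [map_smul]; exact Submodule.smul_mem _ c h) hf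
  rw [hasseDeriv_bin]
  refine Submodule.sum_mem _ fun i hi => Submodule.smul_mem _ _ ?_
  have := mem_range.1 hi
  exact bin_mem_polarSpace (by lia) (by lia)

/-- (1+z)^k and z^k have the same leading term at ∞. -/
theorem bin_add_sub_bin_mem_polarSpace (α b : ℤ) (k : ℕ) :
    bin (α + k) b - bin α (b + k) ∈ polarSpace α (α + b + k - 1) := by
  induction k generalizing b with
  | zero => simp
  | succ k ih =>
    push_cast
    rw [← add_assoc α, bin_succ]
    have h1 := ih (b + 1)
    rw [show b + 1 + (k : ℤ) = b + (k + 1) by ring] at h1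
    rw [add_sub_assoc (bin _ _)]
    exact add_mem (bin_mem_polarSpace (by lia) (by lia)) (polarSpace_mono le_rfl (by lia) h1)

/-- The truncation of the expansion at `z = ∞` of `(1 + z) ^ a` to its first `T` terms. -/
def binTrunc (a : ℤ) (T : ℕ) : ℂ⸨X⸩ :=
  ∑ j ∈ range T, ((Ring.choose a j : ℤ) : ℂ) • bin 0 (a - j)

theorem binTrunc_mem_polarSpace (a : ℤ) (T : ℕ) : binTrunc a T ∈ polarSpace 0 a :=
  Submodule.sum_mem _ fun _ _ => Submodule.smul_mem _ _ (bin_mem_polarSpace le_rfl (by lia))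

theorem binTrunc_sub_binTrunc_mem_polarSpace (a : ℤ) {T T' : ℕ} (h : T ≤ T') :
    binTrunc a T' - binTrunc a T ∈ polarSpace 0 (a - T) := by
  rw [binTrunc, binTrunc, ← sum_range_add_sum_Ico _ h, add_sub_cancel_left]
  refine Submodule.sum_mem _ fun j hj => Submodule.smul_mem _ _ (bin_mem_polarSpace le_rfl ?_)
  have := (mem_Ico.1 hj).1
  lia

/-- Pascal's rule telescopes; only the term next to the cut survives. -/
theorem bin_one_zero_mul_binTrunc (a : ℤ) (T : ℕ) :
    bin 1 0 * binTrunc a (T + 1) = binTrunc (a + 1) (T + 1) +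
      ((Ring.choose a T : ℤ) : ℂ) • bin 0 (a - T) := by
  induction T with
  | zero =>
    have := bin_succ 0 a
    simp only [zero_add] at this
    simp [binTrunc, bin_mul_bin, this, add_comm]
  | succ T ih =>
    rw [binTrunc, sum_range_succ, mul_add, ← binTrunc, ih, binTrunc, binTrunc,
      sum_range_succ _ (T + 1), mul_smul_comm, bin_mul_bin, add_zero]
    have := bin_succ 0 (a - ((T + 1 : ℕ) : ℤ))
    simp only [zero_add] at this
    rw [zero_add, this, Ring.choose_succ_succ]
    push_cast
    rw [show a - ((T : ℤ) + 1) + 1 = a - T by ring, show a + 1 - ((T : ℤ) + 1) = a - T by ring]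
    module

theorem bin_natCast_mul_binTrunc_sub_mem_polarSpace (a : ℤ) (k : ℕ) {T : ℕ} (hT : 0 < T) :
    bin k 0 * binTrunc a T - binTrunc (a + k) T ∈ polarSpace 0 (a + k - T) := by
  obtain ⟨T, rfl⟩ := Nat.exists_eq_add_of_le' hT
  induction k with
  | zero => simp [bin_zero_zero]
  | succ k ih =>
    have h1 := mul_mem_polarSpace (bin_mem_polarSpace (α := 0) (β := 1) (α' := 1) (b := 0)
      (by lia) (by lia)) ih
    have h2 : bin 1 0 * (bin k 0 * binTrunc a (T + 1) - binTrunc (a + k) (T + 1)) =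
        bin (k + 1) 0 * binTrunc a (T + 1) - binTrunc (a + (k + 1)) (T + 1) -
        ((Ring.choose (a + k) T : ℤ) : ℂ) • bin 0 (a + k - T) := by
      rw [mul_sub, ← mul_assoc, bin_mul_bin, bin_one_zero_mul_binTrunc, add_zero, add_comm 1,
        ← add_assoc a, sub_sub]
    rw [h2] at h1
    have h3 := add_mem h1 (Submodule.smul_mem _ ((Ring.choose (a + k) T : ℤ) : ℂ)
      (bin_mem_polarSpace (α := 0 + 0) (β := 1 + (a + k - (T + 1 : ℕ))) (α' := 0)
        (b := a + k - T) (by lia) (by push_cast; lia)))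
    rw [sub_add_cancel] at h3
    push_cast at h3 ⊢
    convert h3 using 2; ring

theorem bin_natCast_zero_eq_binTrunc {k T : ℕ} (h : k < T) : bin k 0 = binTrunc k T := by
  induction k generalizing T with
  | zero =>
    obtain ⟨T, rfl⟩ := Nat.exists_eq_add_of_le' h
    rw [binTrunc, sum_range_succ']
    simp [Ring.choose_zero_succ, LaurentSeries.zero_smul]
  | succ k ih =>
    obtain ⟨T, rfl⟩ := Nat.exists_eq_add_of_le' h
    have h1 := bin_one_zero_mul_binTrunc k (T + k + 1)
    rw [← ih (by lia), bin_mul_bin, choose_natCast_eq_zero (by lia)] at h1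
    simp only [Int.cast_zero, LaurentSeries.zero_smul, add_zero] at h1
    rw [add_comm 1] at h1
    push_cast
    rw [h1]
    rfl

/-- For a ≥ 0 the hypothesis a < T makes the truncation exact; otherwise the difference need not
vanish to order a at -1. For a < 0 multiply by (1+z)^{-a}, which turns the truncation into 1 up to a
tail, and divide again. -/
theorem bin_sub_binTrunc_mem_polarSpace (a : ℤ) {T : ℕ} (hT : 0 < T) (ha : a < T) :
    bin a 0 - binTrunc a T ∈ polarSpace a (a - T) := by
  rcases le_or_gt 0 a with h | h
  · obtain ⟨a, rfl⟩ := Int.eq_ofNat_of_zero_le h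
    rw [bin_natCast_zero_eq_binTrunc (T := T) (by lia), sub_self]
    exact zero_mem _
  · obtain ⟨k, rfl⟩ : ∃ k : ℕ, a = -k := ⟨(-a).toNat, by lia⟩
    have h1 := bin_natCast_mul_binTrunc_sub_mem_polarSpace (-k) k hT
    rw [neg_add_cancel] at h1
    have h0 := bin_natCast_zero_eq_binTrunc hT
    rw [Nat.cast_zero] at h0
    rw [← h0] at h1
    have h2 := mul_mem_polarSpace (bin_mem_polarSpace (α := -k) (β := -k) (α' := -k) (b := 0)
      (by lia) (by lia)) h1
    rw [mul_sub, ← mul_assoc, bin_mul_bin, bin_mul_bin] at h2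
    simp only [neg_add_cancel, add_zero, bin_zero_zero, one_mul, zero_sub] at h2
    rw [← neg_mem_iff, neg_sub]
    simpa [sub_eq_add_neg] using h2

/-- The differential equation (1+z)f' = af of f = (1+z)^a survives truncation up to one boundary
term, by the absorption identity. -/
theorem bin_one_zero_mul_hasseDeriv_binTrunc (a : ℤ) (T : ℕ) :
    bin 1 0 * LaurentSeries.hasseDeriv ℂ 1 (binTrunc a T) - (a : ℂ) • binTrunc a T ∈
      polarSpace 0 (a - T) := by
  have key : bin 1 0 * LaurentSeries.hasseDeriv ℂ 1 (binTrunc a T) =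
      (a : ℂ) • binTrunc a T + ((T * zchoose a T : ℤ) : ℂ) • bin 0 (a - T) := by
    induction T with
    | zero => simp [binTrunc, LaurentSeries.zero_smul]
    | succ T ih =>
      rw [binTrunc, sum_range_succ, ← binTrunc, map_add, mul_add, ih, map_smul,
        hasseDeriv_one_bin, smul_add, ← zchoose_natCast]
      have h2 := bin_succ 0 (a - T - 1)
      rw [sub_add_cancel, zero_add] at h2
      have h3 := zchoose_absorb a (T + 1)
      rw [add_sub_cancel_right] at h3
      push_cast
      have h4 := congrArg (Int.cast : ℤ → ℂ) h3
      push_cast at h4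
      rw [h4]
      simp only [LaurentSeries.zero_smul, smul_zero, zero_add, mul_smul_comm, bin_mul_bin,
        add_zero, h2, sub_add_eq_sub_sub]
      module
  rw [key, add_sub_cancel_left]
  exact Submodule.smul_mem _ _ (bin_mem_polarSpace le_rfl (by lia))

/-! ### Residues, and the Jacobi identity against arbitrary Laurent series -/

theorem finsum_nat_eventually_eq {M : Type*} [AddCommMonoid M] {f : ℕ → M}
    (hf : ∀ᶠ i in atTop, f i = 0) :
    ∀ᶠ H in atTop, ∑ᶠ i, f i = ∑ i ∈ range H, f i := by
  obtain ⟨N, hN⟩ := eventually_atTop.1 hf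
  filter_upwards [eventually_ge_atTop N] with H hH
  refine finsum_eq_sum_of_support_subset _ fun i hi => ?_
  rw [coe_range, Set.mem_Iio]
  by_contra! h
  exact hi (hN i (by lia))

theorem coeff_mul_eq_zero {f g : ℂ⸨X⸩} {N M : ℤ} (hf : ∀ j < N, f.coeff j = 0)
    (hg : ∀ j < M, g.coeff j = 0) : ∀ j < N + M, (f * g).coeff j = 0 := by
  intro j hj
  rw [HahnSeries.coeff_mul]
  refine sum_eq_zero fun x hx => ?_
  have hx' := (mem_antidiagonal.1 hx).2.2
  rcases lt_or_ge x.1 N with h | h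
  · rw [hf _ h, zero_mul]
  · rw [hg _ (by lia), mul_zero]

theorem mono_coeff {f : ℂ⸨X⸩} {N M : ℤ} (h : N ≤ M) (hf : ∀ j < M, f.coeff j = 0) :
    ∀ j < N, f.coeff j = 0 := fun j hj => hf j (hj.trans_le h)

theorem coeff_bin_eq_zero (α β : ℤ) : ∀ j < β, (bin α β).coeff j = 0 := fun j hj => by
  rw [coeff_bin, zchoose_of_neg _ (by lia), Int.cast_zero]

theorem coeff_hasseDeriv_eq_zero {f : ℂ⸨X⸩} {N : ℤ} (hf : ∀ j < N, f.coeff j = 0) (h : ℕ) :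
    ∀ j < N - h, (LaurentSeries.hasseDeriv ℂ h f).coeff j = 0 := fun j hj => by
  rw [LaurentSeries.hasseDeriv_coeff, hf _ (by lia), smul_zero]

/-- A Laurent series is a finite combination of monomials plus a tail of high order, and identities
between residues hold trivially on such tails. -/
theorem laurent_induction {p : ℂ⸨X⸩ → Prop} (hbin : ∀ k, p (bin 0 k))
    (hadd : ∀ f g, p f → p g → p (f + g)) (hsmul : ∀ (c : ℂ) f, p f → p (c • f))
    (htail : ∃ N : ℤ, ∀ f : ℂ⸨X⸩, (∀ j < N, f.coeff j = 0) → p f) (f : ℂ⸨X⸩) : p f := by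
  obtain ⟨N, hN⟩ := htail
  have hzero : p 0 := hN 0 fun _ _ => rfl
  have hf : f = ∑ j ∈ Ico f.order N, f.coeff j • bin 0 j +
      (f - ∑ j ∈ Ico f.order N, f.coeff j • bin 0 j) := by abel
  rw [hf]
  refine hadd _ _ (Finset.sum_induction _ p hadd hzero fun j _ => hsmul _ _ (hbin j))
    (hN _ fun j hj => ?_)
  rw [HahnSeries.coeff_sub, HahnSeries.coeff_sum, sub_eq_zero]
  simp only [← single_eq_bin, HahnSeries.coeff_smul, HahnSeries.coeff_single, smul_eq_mul,
    mul_ite, mul_one, mul_zero, sum_ite_eq, mem_Ico]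
  split_ifs with h
  · rfl
  · exact HahnSeries.coeff_eq_zero_of_lt_order (by lia)

namespace VertexOperatorAlgebra

variable {V : Type*} [AddCommGroup V] [Module ℂ V] (A : VertexOperatorAlgebra V)

theorem mode_add_left (u u' : V) (k : ℤ) : A.mode (u + u') k = A.mode u k + A.mode u' k := by
  simp only [mode, modeOf, map_add, Pi.add_apply]

theorem mode_smul_left (c : ℂ) (u : V) (k : ℤ) : A.mode (c • u) k = c • A.mode u k := by
  simp only [mode, modeOf, map_smul, Pi.smul_apply]

theorem mode_zero_left (k : ℤ) : A.mode 0 k = 0 := by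
  simp only [mode, modeOf, map_zero, Pi.zero_apply]

theorem eventually_mode_eq_zero (u v : V) : ∀ᶠ k : ℤ in atTop, A.mode u k v = 0 := by
  filter_upwards [eventually_gt_atTop
    (-1 - HahnSeries.order ((HahnModule.of ℂ).symm (A.Y u v)))] with k hk
  exact VertexOperator.ncoeff_eq_zero_of_lt_order _ _ _ (by lia)

theorem exists_mode_eq_zero (u v : V) : ∃ N : ℤ, ∀ k ≥ N, A.mode u k v = 0 :=
  eventually_atTop.1 (A.eventually_mode_eq_zero u v)

theorem support_coeff_smul_mode_finite (f : ℂ⸨X⸩) (u v : V) :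
    (Function.support fun j : ℤ => f.coeff j • A.mode u j v).Finite := by
  obtain ⟨N, hN⟩ := A.exists_mode_eq_zero u v
  refine (Set.finite_Ico f.order N).subset fun j hj => ?_
  rw [Function.mem_support] at hj
  constructor
  · by_contra! h
    exact hj (by rw [HahnSeries.coeff_eq_zero_of_lt_order h, zero_smul])
  · by_contra! h
    exact hj (by rw [hN j h, smul_zero])

/-- The residue `Res_z f(z) Y(u,z)v`. -/
def residue : ℂ⸨X⸩ →ₗ[ℂ] V →ₗ[ℂ] V →ₗ[ℂ] V where
  toFun f := LinearMap.mk₂ ℂ (fun u v => ∑ᶠ j : ℤ, f.coeff j • A.mode u j v)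
    (fun u u' v => by
      rw [← finsum_add_distrib (A.support_coeff_smul_mode_finite f u v)
        (A.support_coeff_smul_mode_finite f u' v)]
      simp [mode_add_left])
    (fun c u v => by
      rw [smul_finsum' _ (A.support_coeff_smul_mode_finite f u v)]
      simp [mode_smul_left, smul_comm c])
    (fun u v v' => by
      rw [← finsum_add_distrib (A.support_coeff_smul_mode_finite f u v)
        (A.support_coeff_smul_mode_finite f u v')]
      simp)
    (fun c u v => by
      rw [smul_finsum' _ (A.support_coeff_smul_mode_finite f u v)]
      simp [smul_comm c])
  map_add' f g := by
    ext u v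
    simp only [LinearMap.mk₂_apply, LinearMap.add_apply]
    rw [← finsum_add_distrib (A.support_coeff_smul_mode_finite f u v)
      (A.support_coeff_smul_mode_finite g u v)]
    simp [add_smul]
  map_smul' c f := by
    ext u v
    simp only [LinearMap.mk₂_apply, LinearMap.smul_apply, RingHom.id_apply]
    rw [smul_finsum' _ (A.support_coeff_smul_mode_finite f u v)]
    simp [mul_smul]

theorem residue_apply (f : ℂ⸨X⸩) (u v : V) :
    A.residue f u v = ∑ᶠ j : ℤ, f.coeff j • A.mode u j v := rfl

theorem residue_single (k : ℤ) (u v : V) :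
    A.residue (HahnSeries.single k 1) u v = A.mode u k v := by
  rw [residue_apply, finsum_eq_single _ k]
  · simp
  · intro j hj
    rw [HahnSeries.coeff_single_of_ne hj, zero_smul]

theorem residue_bin_zero (k : ℤ) (u v : V) : A.residue (bin 0 k) u v = A.mode u k v := by
  rw [← single_eq_bin, residue_single]

theorem residue_eq_zero {f : ℂ⸨X⸩} {u v : V} {N : ℤ} (hf : ∀ j < N, f.coeff j = 0)
    (hN : ∀ k ≥ N, A.mode u k v = 0) : A.residue f u v = 0 := by
  rw [residue_apply]
  refine finsum_eq_zero_of_forall_eq_zero fun j => ?_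
  rcases lt_or_ge j N with h | h
  · rw [hf j h, zero_smul]
  · rw [hN j h, smul_zero]

theorem residue_bin (α β : ℤ) (u v : V) :
    A.residue (bin α β) u v = A.res α (-β) u v := by
  rw [residue_apply, res]
  have h1 : ∀ j : ℤ, (bin α β).coeff j • A.mode u j v =
      ∑ᶠ _ : j ∈ Set.range fun i : ℕ => (i : ℤ) + β, (bin α β).coeff j • A.mode u j v := by
    intro j
    classical
    by_cases hj : j ∈ Set.range fun i : ℕ => (i : ℤ) + β
    · rw [finsum_eq_if, if_pos hj]
    · rw [finsum_eq_if, if_neg hj, coeff_bin, zchoose_of_neg, Int.cast_zero, zero_smul]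
      by_contra! h
      exact hj ⟨(j - β).toNat, by simp only []; lia⟩
  rw [finsum_congr h1, finsum_mem_range fun i j h => by simpa using h]
  refine finsum_congr fun i => ?_
  rw [coeff_bin, add_sub_cancel_right, zchoose_natCast, sub_neg_eq_add, Int.cast_smul_eq_zsmul]

theorem eventually_mode_add_eq_zero (u v : V) (k : ℤ) :
    ∀ᶠ i : ℕ in atTop, A.mode u (k + i) v = 0 :=
  (tendsto_atTop_add_const_left _ k tendsto_natCast_atTop_atTop).eventually
    (A.eventually_mode_eq_zero u v)

/-- The Jacobi identity in components, with finite sums. -/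
theorem eventually_jacobi_mode (u v w : V) (l p q : ℤ) :
    ∀ᶠ H : ℕ in atTop,
      ∑ i ∈ range H, Ring.choose p i • A.mode (A.mode u (l + i) v) (p + q - i) w =
        ∑ i ∈ range H, ((-1 : ℤ) ^ i * Ring.choose l i) •
          (A.mode u (p + l - i) (A.mode v (q + i) w)
            - (-1 : ℂ) ^ l • A.mode v (q + l - i) (A.mode u (p + i) w)) := by
  have h := A.jacobi u v w l p q
  change ∑ᶠ i : ℕ, Ring.choose p i • A.mode (A.mode u (l + i) v) (p + q - i) w =
        ∑ᶠ i : ℕ, ((-1 : ℤ) ^ i * Ring.choose l i) •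
          (A.mode u (p + l - i) (A.mode v (q + i) w)
            - (-1 : ℂ) ^ l • A.mode v (q + l - i) (A.mode u (p + i) w)) at h
  have h1 : ∀ᶠ i : ℕ in atTop,
      Ring.choose p i • A.mode (A.mode u (l + i) v) (p + q - i) w = 0 := by
    filter_upwards [A.eventually_mode_add_eq_zero u v l] with i hi
    rw [hi, mode_zero_left, LinearMap.zero_apply, smul_zero]
  have h2 : ∀ᶠ i : ℕ in atTop, ((-1 : ℤ) ^ i * Ring.choose l i) •
      (A.mode u (p + l - i) (A.mode v (q + i) w)
        - (-1 : ℂ) ^ l • A.mode v (q + l - i) (A.mode u (p + i) w)) = 0 := by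
    filter_upwards [A.eventually_mode_add_eq_zero v w q, A.eventually_mode_add_eq_zero u w p]
      with i hi hi'
    rw [hi, hi']
    simp
  filter_upwards [finsum_nat_eventually_eq h1, finsum_nat_eventually_eq h2] with H e1 e2
  rw [← e1, ← e2, h]

/-- The Jacobi identity integrated against `f(x) g(y) (x - y) ^ l`. -/
def JacobiHolds (u v w : V) (l : ℤ) (f g : ℂ⸨X⸩) : Prop :=
  ∀ᶠ H : ℕ in atTop,
    ∑ i ∈ range H, A.residue (LaurentSeries.hasseDeriv ℂ i f * g) (A.mode u (l + i) v) w =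
      ∑ i ∈ range H, (((-1 : ℤ) ^ i * Ring.choose l i : ℤ) : ℂ) •
        (A.residue (bin 0 (l - i) * f) u (A.residue (bin 0 i * g) v w)
          - (-1 : ℂ) ^ l • A.residue (bin 0 (l - i) * g) v (A.residue (bin 0 i * f) u w))

theorem jacobiHolds_bin_zero (u v w : V) (l p q : ℤ) :
    A.JacobiHolds u v w l (bin 0 p) (bin 0 q) := by
  filter_upwards [A.eventually_jacobi_mode u v w l p q] with H h
  have e1 : ∀ i : ℕ, LaurentSeries.hasseDeriv ℂ i (bin 0 p) * bin 0 q =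
      ((Ring.choose p i : ℤ) : ℂ) • bin 0 (p + q - i) := by
    intro i
    rw [hasseDeriv_bin, sum_range_succ', sum_eq_zero]
    · simp only [zero_add, Ring.choose_zero_right, one_mul, Nat.cast_zero, sub_zero, Nat.sub_zero,
        add_zero,
        smul_mul_assoc, bin_mul_bin]
      ring_nf
    · intro j _
      simp [Ring.choose_zero_succ, LaurentSeries.zero_smul]
  simp only [e1, map_smul, LinearMap.smul_apply, bin_mul_bin, residue_bin_zero, add_zero,
    Int.cast_smul_eq_zsmul]
  rw [h]
  refine sum_congr rfl fun i _ => ?_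
  rw [show l - i + p = p + l - i by ring, show l - i + q = q + l - i by ring, add_comm q,
    add_comm p (i : ℤ)]

theorem JacobiHolds.add_left {u v w : V} {l : ℤ} {f f' g : ℂ⸨X⸩}
    (h : A.JacobiHolds u v w l f g) (h' : A.JacobiHolds u v w l f' g) :
    A.JacobiHolds u v w l (f + f') g := by
  filter_upwards [h, h'] with H e e'
  simp only [map_add, add_mul, mul_add, LinearMap.add_apply, sum_add_distrib, e, e']
  rw [← sum_add_distrib]
  exact sum_congr rfl fun i _ => by module

theorem JacobiHolds.add_right {u v w : V} {l : ℤ} {f g g' : ℂ⸨X⸩}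
    (h : A.JacobiHolds u v w l f g) (h' : A.JacobiHolds u v w l f g') :
    A.JacobiHolds u v w l f (g + g') := by
  filter_upwards [h, h'] with H e e'
  simp only [map_add, mul_add, LinearMap.add_apply, sum_add_distrib, e, e']
  rw [← sum_add_distrib]
  exact sum_congr rfl fun i _ => by module

theorem JacobiHolds.smul_left {u v w : V} {l : ℤ} {f g : ℂ⸨X⸩} (c : ℂ)
    (h : A.JacobiHolds u v w l f g) : A.JacobiHolds u v w l (c • f) g := by
  filter_upwards [h] with H e
  simp only [map_smul, smul_mul_assoc, mul_smul_comm, LinearMap.smul_apply, ← smul_sum, e]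
  rw [smul_sum]
  exact sum_congr rfl fun i _ => by module

theorem JacobiHolds.smul_right {u v w : V} {l : ℤ} {f g : ℂ⸨X⸩} (c : ℂ)
    (h : A.JacobiHolds u v w l f g) : A.JacobiHolds u v w l f (c • g) := by
  filter_upwards [h] with H e
  simp only [map_smul, mul_smul_comm, LinearMap.smul_apply, ← smul_sum, e]
  rw [smul_sum]
  exact sum_congr rfl fun i _ => by module

/-- One threshold has to serve all `i`. It exists because only finitely many `i` matter: u_{l+i}v
vanishes for large `i`, the inner residue of y^i g vanishes for large `i`, and the inner residue of
x^i f vanishes for every `i` once f starts late enough. -/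
theorem jacobiHolds_tail_left (u v w : V) (l : ℤ) (g : ℂ⸨X⸩) :
    ∃ N : ℤ, ∀ f : ℂ⸨X⸩, (∀ j < N, f.coeff j = 0) → A.JacobiHolds u v w l f g := by
  have hg : ∀ j < g.order, g.coeff j = 0 := fun j hj => HahnSeries.coeff_eq_zero_of_lt_order hj
  obtain ⟨h₀, hh₀⟩ := eventually_atTop.1 (A.eventually_mode_add_eq_zero u v l)
  obtain ⟨K, hK⟩ := A.exists_mode_eq_zero v w
  obtain ⟨L, hL⟩ := A.exists_mode_eq_zero u w
  have hin : ∀ i : ℕ, (K - g.order).toNat ≤ i → A.residue (bin 0 i * g) v w = 0 := fun i hi =>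
    residue_eq_zero A (coeff_mul_eq_zero (coeff_bin_eq_zero 0 i) hg |> mono_coeff (by lia)) hK
  have e1 : ∀ᶠ N : ℤ in atTop, ∀ i ∈ range h₀, ∀ k ≥ N - i + g.order,
      A.mode (A.mode u (l + i) v) k w = 0 := (eventually_all_finset _).2 fun i _ => by
    obtain ⟨M, hM⟩ := A.exists_mode_eq_zero (A.mode u (l + i) v) w
    filter_upwards [eventually_ge_atTop (M + i - g.order)] with N hN k hk
    exact hM k (by lia)
  have e2 : ∀ᶠ N : ℤ in atTop, ∀ i ∈ range (K - g.order).toNat, ∀ k ≥ l - i + N,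
      A.mode u k (A.residue (bin 0 i * g) v w) = 0 := (eventually_all_finset _).2 fun i _ => by
    obtain ⟨M, hM⟩ := A.exists_mode_eq_zero u (A.residue (bin 0 i * g) v w)
    filter_upwards [eventually_ge_atTop (M + i - l)] with N hN k hk
    exact hM k (by lia)
  obtain ⟨N, h1, h2, h3⟩ := (e1.and (e2.and (eventually_ge_atTop L))).exists
  refine ⟨N, fun f hf => Eventually.of_forall fun H => ?_⟩
  rw [sum_eq_zero, sum_eq_zero]
  · intro i _
    rw [residue_eq_zero A (f := bin 0 i * f)
      (coeff_mul_eq_zero (coeff_bin_eq_zero 0 i) hf |> mono_coeff (N := L) (by lia)) hL]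
    rcases lt_or_ge i (K - g.order).toNat with hi | hi
    · rw [residue_eq_zero A (coeff_mul_eq_zero (coeff_bin_eq_zero 0 _) hf)
        (h2 i (mem_range.2 hi))]
      simp
    · rw [hin i hi]
      simp
  · intro i _
    rcases lt_or_ge i h₀ with hi | hi
    · exact residue_eq_zero A (coeff_mul_eq_zero (coeff_hasseDeriv_eq_zero hf i) hg)
        (h1 i (mem_range.2 hi))
    · rw [hh₀ i hi]
      simp

theorem jacobiHolds_tail_right (u v w : V) (l : ℤ) (f : ℂ⸨X⸩) :
    ∃ N : ℤ, ∀ g : ℂ⸨X⸩, (∀ j < N, g.coeff j = 0) → A.JacobiHolds u v w l f g := by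
  have hf : ∀ j < f.order, f.coeff j = 0 := fun j hj => HahnSeries.coeff_eq_zero_of_lt_order hj
  obtain ⟨h₀, hh₀⟩ := eventually_atTop.1 (A.eventually_mode_add_eq_zero u v l)
  obtain ⟨K, hK⟩ := A.exists_mode_eq_zero u w
  obtain ⟨L, hL⟩ := A.exists_mode_eq_zero v w
  have hin : ∀ i : ℕ, (K - f.order).toNat ≤ i → A.residue (bin 0 i * f) u w = 0 := fun i hi =>
    residue_eq_zero A (coeff_mul_eq_zero (coeff_bin_eq_zero 0 i) hf |> mono_coeff (by lia)) hK
  have e1 : ∀ᶠ N : ℤ in atTop, ∀ i ∈ range h₀, ∀ k ≥ f.order - i + N,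
      A.mode (A.mode u (l + i) v) k w = 0 := (eventually_all_finset _).2 fun i _ => by
    obtain ⟨M, hM⟩ := A.exists_mode_eq_zero (A.mode u (l + i) v) w
    filter_upwards [eventually_ge_atTop (M + i - f.order)] with N hN k hk
    exact hM k (by lia)
  have e2 : ∀ᶠ N : ℤ in atTop, ∀ i ∈ range (K - f.order).toNat, ∀ k ≥ l - i + N,
      A.mode v k (A.residue (bin 0 i * f) u w) = 0 := (eventually_all_finset _).2 fun i _ => by
    obtain ⟨M, hM⟩ := A.exists_mode_eq_zero v (A.residue (bin 0 i * f) u w)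
    filter_upwards [eventually_ge_atTop (M + i - l)] with N hN k hk
    exact hM k (by lia)
  obtain ⟨N, h1, h2, h3⟩ := (e1.and (e2.and (eventually_ge_atTop L))).exists
  refine ⟨N, fun g hg => Eventually.of_forall fun H => ?_⟩
  rw [sum_eq_zero, sum_eq_zero]
  · intro i _
    rw [residue_eq_zero A (f := bin 0 i * g)
      (coeff_mul_eq_zero (coeff_bin_eq_zero 0 i) hg |> mono_coeff (N := L) (by lia)) hL]
    rcases lt_or_ge i (K - f.order).toNat with hi | hi
    · rw [residue_eq_zero A (f := bin 0 (l - i) * g)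
        (coeff_mul_eq_zero (coeff_bin_eq_zero 0 _) hg) (h2 i (mem_range.2 hi))]
      simp
    · rw [hin i hi]
      simp
  · intro i _
    rcases lt_or_ge i h₀ with hi | hi
    · exact residue_eq_zero A (coeff_mul_eq_zero (coeff_hasseDeriv_eq_zero hf i) hg)
        (h1 i (mem_range.2 hi))
    · rw [hh₀ i hi]
      simp

/-- The Jacobi identity integrated against `f(x) g(y) (x - y) ^ l`, where `x` and `y` are the
positions of `u` and `v`. -/
theorem jacobiHolds (u v w : V) (l : ℤ) (f g : ℂ⸨X⸩) : A.JacobiHolds u v w l f g := by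
  refine laurent_induction (p := fun f => A.JacobiHolds u v w l f g) (fun p => ?_)
    (fun _ _ => JacobiHolds.add_left A) (fun c _ => JacobiHolds.smul_left A c)
    (A.jacobiHolds_tail_left u v w l g) f
  exact laurent_induction (p := fun g => A.JacobiHolds u v w l (bin 0 p) g)
    (fun q => A.jacobiHolds_bin_zero u v w l p q)
    (fun _ _ => JacobiHolds.add_right A) (fun c _ => JacobiHolds.smul_right A c)
    (A.jacobiHolds_tail_right u v w l _) g

/-! ### The grading, commutators with L(0) and L(1), skew symmetry -/

theorem component_add (k : ℤ) (u v : V) :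
    A.component k (u + v) = A.component k u + A.component k v := by
  let _ := A.decomposition
  simp [component, DirectSum.decompose_add]

theorem component_smul (k : ℤ) (c : ℂ) (v : V) :
    A.component k (c • v) = c • A.component k v := by
  let _ := A.decomposition
  rw [component, DirectSum.decompose_smul]
  rfl

theorem component_mem (k : ℤ) (v : V) : A.component k v ∈ A.wt k := by
  let _ := A.decomposition
  exact SetLike.coe_mem _

theorem component_of_mem {k : ℤ} {v : V} (hv : v ∈ A.wt k) : A.component k v = v := by
  let _ := A.decomposition
  exact DirectSum.decompose_of_mem_same _ hv

theorem component_of_mem_ne {k l : ℤ} {v : V} (hv : v ∈ A.wt k) (h : k ≠ l) :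
    A.component l v = 0 := by
  let _ := A.decomposition
  exact DirectSum.decompose_of_mem_ne _ hv h

theorem support_component_finite (v : V) :
    (Function.support fun k => A.component k v).Finite := by
  let _ := A.decomposition
  classical
  refine (DFinsupp.support (DirectSum.decompose A.wt v)).finite_toSet.subset fun k hk => ?_
  rw [Function.mem_support] at hk
  rw [SetLike.mem_coe, DFinsupp.mem_support_toFun]
  exact fun h => hk (by rw [component, h]; rfl)

theorem finsum_component (v : V) : ∑ᶠ k, A.component k v = v := by
  let _ := A.decomposition
  classical
  rw [finsum_eq_sum_of_support_subset (s := DFinsupp.support (DirectSum.decompose A.wt v))]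
  · exact DirectSum.sum_support_decompose A.wt v
  · intro k hk
    rw [Function.mem_support] at hk
    rw [SetLike.mem_coe, DFinsupp.mem_support_toFun]
    exact fun h => hk (by rw [component, h]; rfl)

theorem wt_induction {p : V → Prop} (hadd : ∀ u v, p u → p v → p (u + v))
    (hwt : ∀ k, ∀ v ∈ A.wt k, p v) (v : V) : p v := by
  rw [← A.finsum_component v, finsum_eq_sum _ (A.support_component_finite v)]
  exact Finset.sum_induction _ p hadd (hwt 0 0 (zero_mem _)) fun k _ => hwt k _
    (A.component_mem k v)

theorem L_neg_one_eq : A.L (-1) = A.mode A.omega 0 := rfl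

theorem L_zero_eq : A.L 0 = A.mode A.omega 1 := rfl

theorem L_one_eq : A.L 1 = A.mode A.omega 2 := rfl

theorem L_zero_apply {k : ℤ} {v : V} (hv : v ∈ A.wt k) : A.L 0 v = (k : ℂ) • v :=
  A.L_zero k v hv

theorem mode_L_neg_one (u v : V) (k : ℤ) :
    A.mode (A.L (-1) u) k v = (-k : ℂ) • A.mode u (k - 1) v :=
  A.L_neg_one u v k

theorem component_L_zero (k : ℤ) (v : V) : A.component k (A.L 0 v) = (k : ℂ) • A.component k v := by
  induction v using A.wt_induction with
  | hadd u v hu hv => rw [map_add, component_add, component_add, hu, hv, smul_add]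
  | hwt l v hv =>
    rw [A.L_zero_apply hv, component_smul]
    rcases eq_or_ne l k with rfl | h
    · rfl
    · rw [A.component_of_mem_ne hv h, smul_zero, smul_zero]

theorem mem_wt_of_L_zero {k : ℤ} {v : V} (hv : A.L 0 v = (k : ℂ) • v) : v ∈ A.wt k := by
  have h : ∀ l ≠ k, A.component l v = 0 := by
    intro l hl
    have h1 := A.component_L_zero l v
    rw [hv, component_smul, ← sub_eq_zero, ← sub_smul, smul_eq_zero, sub_eq_zero] at h1
    exact h1.resolve_left fun h => hl (by exact_mod_cast h.symm)
  rw [← A.finsum_component v, finsum_eq_single _ k h]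
  exact A.component_mem k v

theorem eventually_commutator (u v w : V) (p q : ℤ) : ∀ᶠ H : ℕ in atTop,
    ∑ i ∈ range H, Ring.choose p i • A.mode (A.mode u i v) (p + q - i) w =
      A.mode u p (A.mode v q w) - A.mode v q (A.mode u p w) := by
  filter_upwards [A.eventually_jacobi_mode u v w 0 p q, eventually_gt_atTop 0] with H h hH
  simp only [zero_add] at h
  rw [h, sum_eq_single_of_mem 0 (mem_range.2 hH)]
  · simp
  · intro i _ hi
    rw [Ring.choose_zero_pos _ (by lia)]
    simp

theorem commutator_natCast (u v w : V) (p : ℕ) (q : ℤ) :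
    A.mode u p (A.mode v q w) - A.mode v q (A.mode u p w) =
      ∑ i ∈ range (p + 1), p.choose i • A.mode (A.mode u i v) (p + q - i) w := by
  obtain ⟨H, h, hH⟩ := ((A.eventually_commutator u v w p q).and
    (eventually_ge_atTop (p + 1))).exists
  rw [← h, ← sum_range_add_sum_Ico _ hH, sum_eq_zero (s := Ico _ _) fun i hi => ?_, add_zero]
  · refine sum_congr rfl fun i _ => ?_
    rw [Ring.choose_natCast, natCast_zsmul]
  · rw [choose_natCast_eq_zero (by have := (mem_Ico.1 hi).1; lia), zero_smul]

/-- The commutator formula for ω_1; the term (ω_0 v)_{q+1} is rewritten by the derivative property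
of L(-1). The next formula is the same with ω_2. -/
theorem L_zero_mode (v w : V) (q : ℤ) :
    A.L 0 (A.mode v q w) = A.mode v q (A.L 0 w) + A.mode (A.L 0 v) q w
      + (-q - 1 : ℂ) • A.mode v q w := by
  have h := A.commutator_natCast A.omega v w 1 q
  simp only [sum_range_succ, range_zero, sum_empty] at h
  have h2 := A.mode_L_neg_one v w (q + 1)
  rw [add_sub_cancel_right, L_neg_one_eq] at h2
  push_cast at h2
  rw [L_zero_eq, show (-q - 1 : ℂ) = -(q + 1) by ring, ← h2]
  rw [sub_eq_iff_eq_add'] at h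
  push_cast at h
  rw [h]
  simp [add_comm, add_left_comm]

theorem L_one_mode (v w : V) (q : ℤ) :
    A.L 1 (A.mode v q w) = A.mode v q (A.L 1 w) + A.mode (A.L 1 v) q w
      + (2 : ℂ) • A.mode (A.L 0 v) (q + 1) w + (-q - 2 : ℂ) • A.mode v (q + 1) w := by
  have h := A.commutator_natCast A.omega v w 2 q
  simp only [sum_range_succ, range_zero, sum_empty] at h
  have h2 := A.mode_L_neg_one v w (q + 2)
  rw [show q + 2 - 1 = q + 1 by ring, L_neg_one_eq] at h2
  push_cast at h2
  rw [L_zero_eq, L_one_eq, show (-q - 2 : ℂ) = -(q + 2) by ring, ← h2]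
  rw [sub_eq_iff_eq_add'] at h
  push_cast at h
  rw [h, show (2 : ℤ) + q - 1 = q + 1 by ring, show (2 : ℤ) + q - 2 = q by ring,
    show (2 : ℤ) + q - 0 = q + 2 by ring]
  simp only [Nat.choose_zero_right, Nat.choose_self, Nat.choose_one_right, one_smul, zero_add,
    ofNat_smul_eq_nsmul ℂ]
  abel

theorem mode_mem_wt {k l : ℤ} {u v : V} (hu : u ∈ A.wt k) (hv : v ∈ A.wt l) (j : ℤ) :
    A.mode u j v ∈ A.wt (k + l - j - 1) := by
  refine A.mem_wt_of_L_zero ?_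
  rw [L_zero_mode, A.L_zero_apply hu, A.L_zero_apply hv, map_smul, mode_smul_left,
    LinearMap.smul_apply]
  push_cast
  module

theorem L_neg_one_mem_wt {k : ℤ} {v : V} (hv : v ∈ A.wt k) : A.L (-1) v ∈ A.wt (k + 1) := by
  have := A.mode_mem_wt A.omega_mem hv 0
  rwa [show 2 + k - 0 - 1 = k + 1 by ring] at this

theorem L_one_mem_wt {k : ℤ} {v : V} (hv : v ∈ A.wt k) : A.L 1 v ∈ A.wt (k - 1) := by
  have := A.mode_mem_wt A.omega_mem hv 2
  rwa [show 2 + k - 2 - 1 = k - 1 by ring] at this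

theorem mode_vacuum (k : ℤ) (v : V) : A.mode A.vacuum k v = if k = -1 then v else 0 :=
  A.vacuum_mode k v

/-- Skew symmetry. -/
theorem eventually_skew_symmetry (u v : V) (l : ℤ) : ∀ᶠ H : ℕ in atTop,
    A.mode v l u = (-1 : ℂ) ^ (l + 1) • ∑ i ∈ range H,
      Ring.choose (-1 : ℤ) i • A.mode (A.mode u (l + i) v) (-1 - i) A.vacuum := by
  -- Nonnegative modes kill the vacuum, so for p = -1 and q = 0 the product side reduces to the term
  -- v_l u_{-1}𝟏 = v_l u.
  filter_upwards [A.eventually_jacobi_mode u v A.vacuum l (-1) 0, eventually_gt_atTop 0]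
    with H h hH
  rw [add_zero] at h
  rw [h, sum_eq_single_of_mem 0 (mem_range.2 hH)]
  · have h0 : A.mode v 0 A.vacuum = 0 := A.mode_vacuum_nonneg v 0 le_rfl
    have h1 : A.mode u (-1) A.vacuum = u := A.mode_vacuum_neg_one u
    have h2 : ((-1 : ℂ) ^ (l + 1) * (-1) ^ l) = -1 := by
      rw [zpow_add₀ (by norm_num), mul_right_comm, ← zpow_add₀ (by norm_num),
        Even.neg_one_zpow ⟨l, rfl⟩]
      norm_num
    simp [h0, h1, smul_smul, h2]
  · intro i _ hi
    have h0 : A.mode v (0 + i) A.vacuum = 0 := A.mode_vacuum_nonneg v _ (by lia)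
    have h1 : A.mode u (-1 + i) A.vacuum = 0 := A.mode_vacuum_nonneg u _ (by lia)
    rw [h0, h1]
    simp

end VertexOperatorAlgebra

/-! ### Membership in O'_{n,m}(V) read off from kernels -/

theorem hasseDeriv_one_bin_mul_binTrunc (α a : ℤ) (T : ℕ) :
    LaurentSeries.hasseDeriv ℂ 1 (bin α 0 * binTrunc a T) =
      (α : ℂ) • (bin (α - 1) 0 * binTrunc a T) +
        bin α 0 * LaurentSeries.hasseDeriv ℂ 1 (binTrunc a T) := by
  simp only [binTrunc, mul_sum, map_sum, smul_sum, ← sum_add_distrib, mul_smul_comm, map_smul,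
    bin_mul_bin, hasseDeriv_one_bin, zero_add, add_zero, smul_add, Int.cast_zero,
    LaurentSeries.zero_smul]
  refine sum_congr rfl fun i _ => ?_
  rw [smul_comm (α : ℂ)]

namespace VertexOperatorAlgebra

variable {V : Type*} [AddCommGroup V] [Module ℂ V] (A : VertexOperatorAlgebra V)

/-- Integration by parts. -/
theorem residue_L_neg_one (f : ℂ⸨X⸩) (u v : V) :
    A.residue f (A.L (-1) u) v = -A.residue (LaurentSeries.hasseDeriv ℂ 1 f) u v := by
  rw [residue_apply, residue_apply, ← finsum_neg_distrib,
    ← finsum_comp_equiv (Equiv.addRight (1 : ℤ))]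
  refine finsum_congr fun j => ?_
  rw [Equiv.coe_addRight, mode_L_neg_one, LaurentSeries.hasseDeriv_coeff]
  simp only [Nat.cast_one, Ring.choose_one_right, add_sub_cancel_right, zsmul_eq_mul]
  push_cast
  module

theorem L_neg_one_add_L_zero (v : V) :
    A.L (-1) v + A.L 0 v = A.residue (bin 1 0) A.omega v := by
  have := bin_succ 0 0
  rw [zero_add] at this
  rw [this, map_add]
  simp [residue_bin_zero, L_neg_one_eq, L_zero_eq]

/-- L(-1) + L(0) is the residue of (1+x)Y(ω,x), and its commutator with Y(u,z) is (1+z)∂Y(u,z) +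
kY(u,z). This moves the second kind of generators of O' through a product. -/
theorem residue_bin_one_zero_omega_residue {k : ℤ} {u : V} (hu : u ∈ A.wt k) (f : ℂ⸨X⸩) (v : V) :
    A.residue (bin 1 0) A.omega (A.residue f u v) =
      A.residue f u (A.residue (bin 1 0) A.omega v) + (k : ℂ) • A.residue f u v
        - A.residue (LaurentSeries.hasseDeriv ℂ 1 (bin 1 0 * f)) u v := by
  obtain ⟨H, h, hH⟩ :=
    ((A.jacobiHolds A.omega u v 0 (bin 1 0) f).and (eventually_ge_atTop 2)).exists
  rw [← sum_range_add_sum_Ico _ hH, sum_eq_zero (s := Ico _ _), add_zero,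
    sum_eq_single_of_mem (s := range H) 0 (mem_range.2 (by lia))] at h
  · have e1 : LaurentSeries.hasseDeriv ℂ 1 (bin 1 0) = 1 := by
      rw [hasseDeriv_one_bin]
      simp [LaurentSeries.zero_smul, bin_zero_zero]
    rw [sum_range_succ, sum_range_one, e1] at h
    simp only [LaurentSeries.hasseDeriv_zero, LinearMap.id_coe, id_eq, Nat.cast_zero, add_zero,
      Nat.cast_one, zero_add, ← L_neg_one_eq, ← L_zero_eq, A.L_zero_apply hu, map_smul, one_mul,
      sub_zero, bin_zero_zero, residue_L_neg_one, pow_zero, Ring.choose_zero_right, mul_one,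
      Int.cast_one, one_smul, zpow_zero, LinearMap.smul_apply] at h
    rw [eq_sub_iff_add_eq] at h
    rw [← h]
    abel
  · intro i _ hi
    rw [Ring.choose_zero_pos _ (by lia), mul_zero, Int.cast_zero, zero_smul]
  · intro i hi
    have hi' := (mem_Ico.1 hi).1
    have : LaurentSeries.hasseDeriv ℂ i (bin 1 0) = 0 := by
      rw [hasseDeriv_bin]
      refine sum_eq_zero fun j hj => ?_
      have hj' := mem_range.1 hj
      rcases lt_or_ge j i with h | h
      · rw [Ring.choose_zero_pos _ (by lia), mul_zero, Int.cast_zero, LaurentSeries.zero_smul]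
      · have := choose_natCast_eq_zero (k := 1) (h := j) (by lia)
        rw [Nat.cast_one] at this
        rw [this, zero_mul, Int.cast_zero, LaurentSeries.zero_smul]
    rw [this]
    simp

theorem L_neg_one_add_smul_mem_O' (n m : ℕ) {k : ℤ} {u : V} (hu : u ∈ A.wt k) :
    A.L (-1) u + (k + m - n : ℂ) • u ∈ A.O' n m := by
  refine Submodule.subset_span (Or.inr ⟨u, ?_⟩)
  rw [A.L_zero_apply hu]
  module

/-- The generators have z-exponent -(n+m+2). Integrating by parts against L(-1)u, whose weight is
k+1, lowers the exponent from σ to σ-1 at the cost of a factor σ, which is nonzero because σ ≤ -2.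
-/
theorem residue_mem_O' {n m : ℕ} {k : ℤ} {u : V} (hu : u ∈ A.wt k) {f : ℂ⸨X⸩}
    (hf : f ∈ polarSpace (k + m) (k - 2 - n)) (v : V) : A.residue f u v ∈ A.O' n m := by
  refine polarSpace_induction (p := fun f => A.residue f u v ∈ A.O' n m) (fun b hb => ?_)
    (by simp) (fun f g h1 h2 => by rw [map_add]; exact add_mem h1 h2)
    (fun c f h => by rw [map_smul]; exact Submodule.smul_mem _ c h) hf
  obtain ⟨s, rfl⟩ : ∃ s : ℕ, b = -(n + m + 2 : ℤ) - s := ⟨(-(n + m + 2 : ℤ) - b).toNat, by lia⟩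
  clear hb hf
  induction s generalizing k u with
  | zero =>
    refine Submodule.subset_span (Or.inl ⟨k, u, hu, v, ?_⟩)
    rw [residue_bin]
    simp
  | succ s ih =>
    have h1 := ih (A.L_neg_one_mem_wt hu)
    have h2 := ih hu
    set σ : ℤ := -(n + m + 2 : ℤ) - s with hσ
    rw [residue_L_neg_one, hasseDeriv_one_bin, show k + 1 + (m : ℤ) - 1 = k + m by ring] at h1
    have h3 := bin_succ (k + m) (σ - 1)
    rw [sub_add_cancel, show k + (m : ℤ) + 1 = k + 1 + m by ring] at h3
    rw [h3] at h1
    rw [show -(n + m + 2 : ℤ) - (s + 1 : ℕ) = σ - 1 by rw [hσ]; push_cast; ring]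
    have h4 := add_mem h1 (Submodule.smul_mem _ ((k + 1 + m : ℤ) + σ : ℂ) h2)
    simp only [map_add, map_smul, LinearMap.add_apply, LinearMap.smul_apply] at h4
    have h5 : (σ : ℂ) ≠ 0 := by exact_mod_cast (by lia : σ ≠ 0)
    rw [← Submodule.smul_mem_iff _ (neg_ne_zero.2 h5)]
    convert h4 using 1
    module

/-- Products of two vertex operators acting trivially modulo `O'_{n,m}(V)`. -/
theorem residue_bin_residue_bin_mem_O' {n m : ℕ} {k l : ℤ} {a b : V} (ha : a ∈ A.wt k)
    (hb : b ∈ A.wt l) (c : V) {r s : ℤ} (h : (n + 2 * m + 3 : ℤ) ≤ r + s) :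
    A.residue (bin (k + m) (-r)) a (A.residue (bin (l + m) (-s)) b c) ∈ A.O' n m := by
  obtain ⟨t, ht⟩ : ∃ t : ℕ, (n + m + 2 : ℤ) - r ≤ t := ⟨((n + m + 2 : ℤ) - r).toNat, by lia⟩
  induction t generalizing r s with
  | zero => exact A.residue_mem_O' ha (bin_mem_polarSpace le_rfl (by lia)) _
  | succ t ih =>
    -- The induction hypothesis covers every outer kernel of smaller degree at ∞, the sum of the two
    -- pole orders staying large.
    have ihp : ∀ s f, ∀ r' > r, (n + 2 * m + 3 : ℤ) ≤ r' + s → f ∈ polarSpace (k + m) (k + m - r') →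
        A.residue f a (A.residue (bin (l + m) (-s)) b c) ∈ A.O' n m := by
      intro s f r' hr' hrs hf
      refine polarSpace_induction (p := fun f => A.residue f a _ ∈ A.O' n m) (fun b hb => ?_)
        (by simp) (fun f g h1 h2 => by rw [map_add]; exact add_mem h1 h2)
        (fun c f h => by rw [map_smul]; exact Submodule.smul_mem _ c h) hf
      have := ih (r := -b) (s := s) (by lia) (by push_cast at ht ⊢; lia)
      rwa [neg_neg] at this
    -- The factor (x-y)^{-L} raises the pole of the b-kernel to order at least n+m+2, so the terms
    -- with b outermost fall into O'. The compensating (1+x)^L leaves (1+x)^{k+m} x^{-r} as leading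
    -- part of the term i = 0.
    obtain ⟨L, hL⟩ : ∃ L : ℕ, (n + m + 2 : ℤ) - s ≤ L := ⟨((n + m + 2 : ℤ) - s).toNat, by lia⟩
    obtain ⟨H, hJ, hH⟩ := ((A.jacobiHolds a b c (-L) (bin (k + m + L) (-r))
      (bin (l + m) (-s))).and (eventually_gt_atTop 0)).exists
    obtain ⟨H, rfl⟩ := Nat.exists_eq_add_of_le' hH
    simp only [bin_mul_bin, zero_add, smul_sub, sum_sub_distrib] at hJ
    rw [eq_sub_iff_add_eq, sum_range_succ' (fun i => _ • A.residue _ a _), ← sub_eq_iff_eq_add',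
      Nat.cast_zero] at hJ
    have hlead := bin_add_sub_bin_mem_polarSpace (k + m) (-L + -r) L
    have e : A.residue (bin (k + m) (-r)) a (A.residue (bin (l + m) (-s)) b c) =
        A.residue (bin (k + m + L) (-L - (0 : ℤ) + -r)) a (A.residue (bin (l + m) (0 + -s)) b c) -
        A.residue (bin (k + m + L) (-L + -r) - bin (k + m) (-L + -r + L)) a
          (A.residue (bin (l + m) (-s)) b c) := by
      rw [map_sub, sub_zero, zero_add, show (-L + -r + L : ℤ) = -r by ring]
      simp
    rw [e]
    refine sub_mem ?_ (ihp s _ (r + 1) (by lia) (by lia) (polarSpace_mono le_rfl (by lia) hlead))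
    simp only [pow_zero, Ring.choose_zero_right, mul_one, Int.cast_one, one_smul] at hJ
    rw [← hJ]
    refine sub_mem (add_mem ?_ ?_) ?_
    -- For the iterates a_{-L+h}b, of weight k+l+L-h-1, the required degree bound at ∞ is precisely
    -- n+2m+3 ≤ r+s.
    · refine Submodule.sum_mem _ fun h _ => ?_
      have h1 := mul_mem_polarSpace (hasseDeriv_mem_polarSpace
        (bin_mem_polarSpace (α := k + m + L) (β := k + m + L - r) (b := -r) le_rfl (by lia)) h)
        (bin_mem_polarSpace (α := l + m) (β := l + m - s) (b := -s) le_rfl (by lia))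
      exact A.residue_mem_O' (A.mode_mem_wt ha hb _)
        (polarSpace_mono (by lia) (by lia) h1) _
    · refine Submodule.sum_mem _ fun h _ => Submodule.smul_mem _ _ (Submodule.smul_mem _ _ ?_)
      exact A.residue_mem_O' hb (bin_mem_polarSpace le_rfl (by lia)) _
    · refine Submodule.sum_mem _ fun i _ => Submodule.smul_mem _ _ ?_
      rw [show ((i + 1 : ℕ) : ℤ) + -s = -(s - (i + 1 : ℕ)) by ring]
      exact ihp _ _ (r + (i + 1 : ℕ)) (by push_cast; lia) (by lia)
        (bin_mem_polarSpace (by lia) (by lia))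

theorem residue_residue_mem_O' {n m : ℕ} {k l : ℤ} {a b : V} (ha : a ∈ A.wt k)
    (hb : b ∈ A.wt l) (c : V) {f g : ℂ⸨X⸩} {α β : ℤ} (hf : f ∈ polarSpace (k + m) α)
    (hg : g ∈ polarSpace (l + m) β) (h : α + β ≤ k + l - n - 3) :
    A.residue f a (A.residue g b c) ∈ A.O' n m := by
  refine polarSpace_induction (p := fun f => A.residue f a _ ∈ A.O' n m) (fun r hr => ?_)
    (by simp) (fun f g h1 h2 => by rw [map_add]; exact add_mem h1 h2)
    (fun c f h => by rw [map_smul]; exact Submodule.smul_mem _ c h) hf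
  refine polarSpace_induction (p := fun g => A.residue (bin (k + m) r) a (A.residue g b c) ∈ _)
    (fun s hs => ?_)
    (by simp) (fun f g h1 h2 => by
      rw [map_add, LinearMap.add_apply, LinearMap.add_apply, map_add]; exact add_mem h1 h2)
    (fun c f h => by
      rw [map_smul, LinearMap.smul_apply, LinearMap.smul_apply, map_smul]
      exact Submodule.smul_mem _ c h) hg
  have := A.residue_bin_residue_bin_mem_O' (n := n) (m := m) ha hb c (r := -r) (s := -s) (by lia)
  rwa [neg_neg, neg_neg] at this

/-- The function `f` such that `u ∗_{m,p}^n v` is the residue of `f(z) Y(u,z)v` for `u` of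
weight `k`. -/
def starFun (m p n : ℕ) (k : ℤ) : ℂ⸨X⸩ :=
  bin (k + m) 0 * binTrunc ((p : ℤ) - n - m - 1) (p + 1)

theorem starFun_mem_polarSpace (m p n : ℕ) (k : ℤ) :
    starFun m p n k ∈ polarSpace (k + m) (k + p - n - 1) := by
  have := mul_mem_polarSpace (bin_mem_polarSpace (α := k + m) (β := k + m) (b := 0) le_rfl
    (by lia)) (binTrunc_mem_polarSpace ((p : ℤ) - n - m - 1) (p + 1))
  exact polarSpace_mono (by lia) (by lia) this

/-- Upper negation: (-1)^i (m+n-p+i choose i) = (p-n-m-1 choose i). -/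
theorem residue_starFun (m p n : ℕ) (k : ℤ) (u v : V) :
    A.residue (starFun m p n k) u v = ∑ i ∈ Finset.range (p + 1),
      ((-1 : ℤ) ^ i * Ring.choose ((m : ℤ) + n - p + i) i) •
        A.res (k + m) ((m : ℤ) + n - p + i + 1) u v := by
  rw [starFun, binTrunc, mul_sum, map_sum, LinearMap.sum_apply, LinearMap.sum_apply]
  refine sum_congr rfl fun i _ => ?_
  rw [mul_smul_comm, bin_mul_bin, map_smul, LinearMap.smul_apply, LinearMap.smul_apply,
    residue_bin, Int.cast_smul_eq_zsmul]
  have h1 := Ring.choose_neg ((m : ℤ) + n - p + 1) i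
  rw [show -((m : ℤ) + n - p + 1) = p - n - m - 1 by ring,
    show (m : ℤ) + n - p + 1 + i - 1 = m + n - p + i by ring] at h1
  rw [h1, show -(0 + ((p : ℤ) - n - m - 1 - i)) = m + n - p + i + 1 by ring, add_zero,
    Units.smul_def, Int.coe_negOnePow_natCast, smul_eq_mul]

theorem starProd_eq_finsum (m p n : ℕ) (u v : V) :
    A.starProd m p n u v = ∑ᶠ k : ℤ, A.residue (starFun m p n k) (A.component k u) v := by
  simp only [residue_starFun, starProd]

theorem support_residue_component_finite (f : ℤ → ℂ⸨X⸩) (u v : V) :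
    (Function.support fun k => A.residue (f k) (A.component k u) v).Finite := by
  refine (A.support_component_finite u).subset fun k hk => ?_
  rw [Function.mem_support] at hk ⊢
  exact fun h => hk (by rw [h, map_zero, LinearMap.zero_apply])

/-- The product `u ∗_{m,p}^n v` as a bilinear map. -/
def star (m p n : ℕ) : V →ₗ[ℂ] V →ₗ[ℂ] V :=
  LinearMap.mk₂ ℂ (A.starProd m p n)
    (fun u u' v => by
      simp only [starProd_eq_finsum, component_add, map_add, LinearMap.add_apply]
      exact finsum_add_distrib (A.support_residue_component_finite _ u v)
        (A.support_residue_component_finite _ u' v))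
    (fun c u v => by
      simp only [starProd_eq_finsum, component_smul, map_smul, LinearMap.smul_apply]
      exact (smul_finsum' c (A.support_residue_component_finite _ u v)).symm)
    (fun u v v' => by
      simp only [starProd_eq_finsum, map_add]
      exact finsum_add_distrib (A.support_residue_component_finite _ u v)
        (A.support_residue_component_finite _ u v'))
    (fun c u v => by
      simp only [starProd_eq_finsum, map_smul]
      exact (smul_finsum' c (A.support_residue_component_finite _ u v)).symm)

theorem star_apply (m p n : ℕ) (u v : V) : A.star m p n u v = A.starProd m p n u v := rfl

theorem star_of_mem_wt (m p n : ℕ) {k : ℤ} {u : V} (hu : u ∈ A.wt k) (v : V) :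
    A.star m p n u v = A.residue (starFun m p n k) u v := by
  rw [star_apply, starProd_eq_finsum, finsum_eq_single _ k, A.component_of_mem hu]
  intro l hl
  rw [A.component_of_mem_ne hu hl.symm, map_zero, LinearMap.zero_apply]

/-- At ∞ the kernel is (1+z)^{k+p-n-1}, for which the expression would vanish identically. This
makes the products compatible with the relations L(-1)u + (L(0)+m-n)u on either side. -/
theorem hasseDeriv_starFun_mem_polarSpace (m p n : ℕ) (k : ℤ) :
    (k + p - n : ℂ) • starFun m p n k - LaurentSeries.hasseDeriv ℂ 1 (bin 1 0 * starFun m p n k) ∈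
      polarSpace (k + m) (k - 2 - n) := by
  have h1 := mul_mem_polarSpace (bin_mem_polarSpace (α := k + m) (β := k + m) (b := 0) le_rfl
    (by lia)) (bin_one_zero_mul_hasseDeriv_binTrunc ((p : ℤ) - n - m - 1) (p + 1))
  rw [starFun, ← mul_assoc, bin_mul_bin, add_zero, hasseDeriv_one_bin_mul_binTrunc,
    show 1 + (k + (m : ℤ)) - 1 = k + m by ring]
  have h2 : bin (1 + (k + m)) 0 = bin (k + m) 0 * bin 1 0 := by
    rw [bin_mul_bin, add_comm, add_zero]
  rw [h2]
  have h3 : (k + p - n : ℂ) • (bin (k + m) 0 * binTrunc ((p : ℤ) - n - m - 1) (p + 1)) -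
      (((1 + (k + m) : ℤ) : ℂ) • (bin (k + m) 0 * binTrunc ((p : ℤ) - n - m - 1) (p + 1)) +
        bin (k + m) 0 * bin 1 0 *
          LaurentSeries.hasseDeriv ℂ 1 (binTrunc ((p : ℤ) - n - m - 1) (p + 1))) =
      - (bin (k + m) 0 * (bin 1 0 *
          LaurentSeries.hasseDeriv ℂ 1 (binTrunc ((p : ℤ) - n - m - 1) (p + 1)) -
        (((p : ℤ) - n - m - 1 : ℤ) : ℂ) • binTrunc ((p : ℤ) - n - m - 1) (p + 1))) := by
    rw [mul_sub, mul_smul_comm, mul_assoc]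
    push_cast
    module
  rw [h3, neg_mem_iff]
  exact polarSpace_mono (by lia) (by push_cast; lia) h1

/-- The product with a representative of `u` in a shifted form. -/
theorem residue_shifted_sub_star_mem_O' (m p n ρ : ℕ) {T : ℕ} (hT : p < T) {k : ℤ} {u : V}
    (hu : u ∈ A.wt k) (v : V) :
    A.residue (bin (k + m + ρ) 0 * binTrunc ((p : ℤ) - n - m - 1 - ρ) T) u v
      - A.star m p n u v ∈ A.O' n m := by
  rw [A.star_of_mem_wt _ _ _ hu, ← LinearMap.sub_apply, ← LinearMap.sub_apply, ← map_sub]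
  refine A.residue_mem_O' hu ?_ v
  -- Moving a factor (1+z)^ρ in or out of the truncation, or lengthening it, changes only the
  -- negligible tail.
  have h1 := bin_natCast_mul_binTrunc_sub_mem_polarSpace ((p : ℤ) - n - m - 1 - ρ) ρ
    (T := T) (by lia)
  rw [sub_add_cancel] at h1
  have h2 := add_mem (polarSpace_mono le_rfl (by lia) h1)
    (binTrunc_sub_binTrunc_mem_polarSpace ((p : ℤ) - n - m - 1) (T := p + 1) hT)
  rw [sub_add_sub_cancel] at h2
  have h3 := mul_mem_polarSpace (bin_mem_polarSpace (α := k + m) (β := k + m) (b := 0) le_rfl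
    (by lia)) h2
  rw [mul_sub, ← mul_assoc, bin_mul_bin, add_zero] at h3
  exact polarSpace_mono (by lia) (by push_cast; lia) h3

theorem star_mem_O'_of_right_mem (m p n : ℕ) (a : V) {w : V} (hw : w ∈ A.O' p m) :
    A.star m p n a w ∈ A.O' n m := by
  induction a using A.wt_induction with
  | hadd u v hu hv => rw [map_add, LinearMap.add_apply]; exact add_mem hu hv
  | hwt k a ha =>
  induction hw using Submodule.span_induction with
  | zero => simp
  | add x y _ _ hx hy => rw [map_add]; exact add_mem hx hy
  | smul c x _ hx => rw [map_smul]; exact Submodule.smul_mem _ c hx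
  | mem w hw =>
    rw [A.star_of_mem_wt _ _ _ ha]
    rcases hw with ⟨l, b, hb, c, rfl⟩ | ⟨c, rfl⟩
    -- The degrees at ∞ are k+p-n-1 and l-p-2; their sum is exactly the admissible k+l-n-3.
    · rw [← neg_neg ((p : ℤ) + m + 2), ← residue_bin]
      exact A.residue_residue_mem_O' ha hb c (starFun_mem_polarSpace m p n k)
        (bin_mem_polarSpace (β := l - p - 2) le_rfl (by lia)) (by lia)
    · have h1 := A.residue_bin_one_zero_omega_residue ha (starFun m p n k) c
      have h2 : A.L (-1) (A.residue (starFun m p n k) a c) +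
        (A.L 0 (A.residue (starFun m p n k) a c) + ((m : ℂ) - n) •
          A.residue (starFun m p n k) a c) ∈ A.O' n m := Submodule.subset_span (Or.inr ⟨_, rfl⟩)
      have h3 := A.residue_mem_O' ha (hasseDeriv_starFun_mem_polarSpace m p n k) c
      rw [← add_assoc, L_neg_one_add_L_zero, h1] at h2
      rw [← add_assoc, L_neg_one_add_L_zero]
      convert sub_mem h2 h3 using 1
      simp only [map_add, map_sub, map_smul, LinearMap.sub_apply, LinearMap.smul_apply]
      module

end VertexOperatorAlgebra

/-! ### Combinatorics of the iterate formula -/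

/-- The coefficients of the expansion of `(1 - t) ^ (-N)`. -/
def negBinom (N i : ℤ) : ℤ := zchoose (N - 1 + i) i

theorem negBinom_sub (N i : ℤ) : negBinom N i - negBinom N (i - 1) = negBinom (N - 1) i := by
  have := zchoose_succ (N - 1 + i - 1) i
  rw [sub_add_cancel] at this
  rw [negBinom, negBinom, negBinom, this, show N - 1 + (i - 1) = N - 1 + i - 1 by ring,
    show N - 1 - 1 + i = N - 1 + i - 1 by ring]
  ring

theorem negBinom_zero_left {i : ℤ} (hi : i ≠ 0) : negBinom 0 i = 0 := by
  rcases lt_or_ge i 0 with h | h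
  · exact zchoose_of_neg _ h
  · obtain ⟨j, rfl⟩ : ∃ j : ℕ, i = (j : ℤ) + 1 := ⟨(i - 1).toNat, by lia⟩
    have := zchoose_natCast j (j + 1)
    rw [choose_natCast_eq_zero (by lia)] at this
    rw [negBinom, show (0 : ℤ) - 1 + (j + 1) = j by ring]
    exact_mod_cast this

theorem negBinom_natCast (N : ℤ) (i : ℕ) : negBinom N i = (-1) ^ i * Ring.choose (-N) i := by
  rw [negBinom, zchoose_natCast, Ring.choose_neg, Units.smul_def, Int.coe_negOnePow_natCast,
    smul_eq_mul, ← mul_assoc, ← mul_pow, show N - 1 + (i : ℤ) = N + i - 1 by ring]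
  simp

/-- Comparison of coefficients in the identity
`(z - w) ^ (-N) x ^ a y ^ b = ∑ i, negBinom N i x ^ (a - N - i) y ^ (b + i)`,
where `x = 1 + z` and `y = 1 + w` are expanded at infinity. -/
theorem sum_negBinom_mul_zchoose (a b N k : ℤ) {d : ℤ} {R : ℕ} (hd : d < R) :
    ∑ j ∈ range R, negBinom N (k - j) * (zchoose a j * zchoose b (d - j)) =
      ∑ j ∈ range R, negBinom N (k - j) *
        (zchoose (a - N - k + j) j * zchoose (b + k - j) (d - j)) := by
  -- Both sides satisfy S(N,k) - S(N,k-1) = S(N-1,k), vanish for k < 0, and reduce to the term j = k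
  -- for N = 0. The recursion then reaches every integer N: upwards by induction on k, downwards
  -- directly.
  set S₁ : ℤ → ℤ → ℤ := fun N k =>
    ∑ j ∈ range R, negBinom N (k - j) * (zchoose a j * zchoose b (d - j)) with hS₁
  set S₂ : ℤ → ℤ → ℤ := fun N k => ∑ j ∈ range R, negBinom N (k - j) *
        (zchoose (a - N - k + j) j * zchoose (b + k - j) (d - j)) with hS₂
  have h1 : ∀ N k, S₁ N k - S₁ N (k - 1) = S₁ (N - 1) k := by
    intro N k
    simp only [hS₁]
    rw [← sum_sub_distrib]
    refine sum_congr rfl fun j _ => ?_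
    rw [← negBinom_sub N (k - j), show k - 1 - (j : ℤ) = k - j - 1 by ring]
    ring
  have h2 : ∀ N k, S₂ N k - S₂ N (k - 1) = S₂ (N - 1) k := by
    intro N k
    -- Pascal's rule on both binomials leaves two sums differing by the shift j ↦ j+1; the end term
    -- is zero because d < R.
    have hX : ∑ j ∈ range R, negBinom N (k - j) *
          (zchoose (a - N - k + j) (j - 1) * zchoose (b + k - j) (d - j)) =
        ∑ j ∈ range R, negBinom N (k - 1 - j) *
          (zchoose (a - N - k + 1 + j) j * zchoose (b + k - 1 - j) (d - 1 - j)) := by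
      rcases Nat.eq_zero_or_pos R with h | h
      · simp [h]
      · obtain ⟨R', hR'⟩ := Nat.exists_eq_add_of_le' h
        rw [hR', sum_range_succ', sum_range_succ (fun j : ℕ => negBinom N (k - 1 - j) * _),
          zchoose_of_neg _ (j := ((0 : ℕ) : ℤ) - 1) (by simp),
          zchoose_of_neg _ (j := d - 1 - (R' : ℤ)) (by lia)]
        simp only [zero_mul, mul_zero, add_zero]
        refine sum_congr rfl fun j _ => ?_
        push_cast
        rw [show k - ((j : ℤ) + 1) = k - 1 - j by ring, show (j : ℤ) + 1 - 1 = j by ring,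
          show a - N - k + ((j : ℤ) + 1) = a - N - k + 1 + j by ring,
          show b + k - ((j : ℤ) + 1) = b + k - 1 - j by ring,
          show d - ((j : ℤ) + 1) = d - 1 - j by ring]
    rw [← sub_eq_zero] at hX ⊢
    rw [← neg_eq_zero, ← hX]
    simp only [hS₂]
    rw [← sum_sub_distrib, ← sum_sub_distrib, ← sum_sub_distrib, ← sum_neg_distrib]
    refine sum_congr rfl fun j _ => ?_
    rw [← negBinom_sub N (k - j), show k - 1 - (j : ℤ) = k - j - 1 by ring]
    have e1 := zchoose_succ (a - N - k + j) j
    have e2 := zchoose_succ (b + k - 1 - j) (d - j)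
    rw [show b + k - 1 - (j : ℤ) + 1 = b + k - j by ring] at e2
    rw [show a - (N - 1) - k + (j : ℤ) = a - N - k + j + 1 by ring,
      show a - N - (k - 1) + (j : ℤ) = a - N - k + j + 1 by ring,
      show a - N - k + 1 + (j : ℤ) = a - N - k + j + 1 by ring,
      show b + (k - 1) - (j : ℤ) = b + k - 1 - j by ring,
      show d - 1 - (j : ℤ) = d - j - 1 by ring, e2, e1]
    ring
  have hneg : ∀ N k, k < 0 → S₁ N k = S₂ N k := by
    intro N k hk
    simp only [hS₁, hS₂]
    refine sum_congr rfl fun j _ => ?_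
    rw [negBinom, zchoose_of_neg _ (by lia), zero_mul, zero_mul]
  suffices h : ∀ N k, S₁ N k = S₂ N k from h N k
  clear N k
  intro N
  induction N using Int.induction_on with
  | zero =>
    intro k
    simp only [hS₁, hS₂]
    refine sum_congr rfl fun j _ => ?_
    rcases eq_or_ne k j with rfl | h
    · simp
    · rw [negBinom_zero_left (by lia), zero_mul, zero_mul]
  | succ N ih =>
    intro k
    rcases lt_or_ge k 0 with hk | hk
    · exact hneg _ _ hk
    · lift k to ℕ using hk
      induction k with
      | zero =>
        have e1 := h1 (N + 1) 0
        have e2 := h2 (N + 1) 0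
        have e3 := hneg (N + 1) (0 - 1) (by lia)
        have e4 := ih 0
        rw [add_sub_cancel_right] at e1 e2
        simp only [Nat.cast_zero]
        linarith
      | succ k ihk =>
        have e1 := h1 (N + 1) (k + 1)
        have e2 := h2 (N + 1) (k + 1)
        have e4 := ih (k + 1)
        rw [add_sub_cancel_right, add_sub_cancel_right] at e1 e2
        push_cast
        linarith
  | pred N ih =>
    intro k
    rw [← h1, ← h2, ih, ih]

theorem sum_range_shift {M : Type*} [AddCommGroup M] [Module ℂ M] {f : ℤ → ℂ} {g : ℕ → M} {R : ℕ}
    (j : ℕ) (hf : ∀ i < 0, f i = 0) (hg : ∀ k ≥ R, g k = 0) :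
    ∑ i ∈ range R, f i • g (i + j) = ∑ k ∈ range R, f (k - j) • g k := by
  have e1 : ∑ k ∈ range R, f (k - j) • g k = ∑ k ∈ range (R + j), f (k - j) • g k := by
    refine sum_subset (range_mono (by lia)) fun k _ hk => ?_
    rw [hg k (by simpa using hk), smul_zero]
  have e2 : ∑ k ∈ range j, f (k - j) • g k = 0 := sum_eq_zero fun k hk => by
    have := mem_range.1 hk
    rw [hf _ (by lia), zero_smul]
  rw [e1, add_comm R j, sum_range_add, e2, zero_add]
  refine sum_congr rfl fun i _ => ?_
  rw [add_comm j i]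
  push_cast
  rw [add_sub_cancel_right]

/-- Rearrangement of a triple sum along `(i + j₁, j₁ + j₂)`. -/
theorem sum_sum_sum_shift {M : Type*} [AddCommGroup M] [Module ℂ M] {c : ℤ → ℤ → ℂ}
    {f g : ℤ → ℤ → ℂ} {γ : ℕ → ℕ → M} {R : ℕ}
    (hc : ∀ i j, i < 0 → c i j = 0) (hg : ∀ i j, j < 0 → g i j = 0)
    (h1 : ∀ k d, R ≤ k → γ k d = 0) (h2 : ∀ k d, R ≤ d → γ k d = 0) :
    ∑ i ∈ range R, ∑ j₁ ∈ range R, ∑ j₂ ∈ range R,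
      (c i j₁ * (f i j₁ * g i j₂)) • γ (i + j₁) (j₁ + j₂) =
    ∑ k ∈ range R, ∑ d ∈ range R,
      (∑ j ∈ range R, c (k - j) j * (f (k - j) j * g (k - j) (d - j))) • γ k d := by
  have e1 : ∀ i j₁ : ℕ, ∑ j₂ ∈ range R, (c i j₁ * (f i j₁ * g i j₂)) • γ (i + j₁) (j₁ + j₂) =
      c i j₁ • f i j₁ • ∑ d ∈ range R, g i (d - j₁) • γ (i + j₁) d := by
    intro i j₁
    rw [← sum_range_shift (f := fun j => g i j) j₁ (fun j hj => hg _ _ hj) fun k hk => h2 _ _ hk,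
      smul_sum, smul_sum]
    refine sum_congr rfl fun j₂ _ => ?_
    rw [mul_smul, mul_smul, add_comm j₂]
  simp only [e1]
  rw [sum_comm]
  have e2 : ∀ j₁ : ℕ, ∑ i ∈ range R,
      c i j₁ • f i j₁ • ∑ d ∈ range R, g i (d - j₁) • γ (i + j₁) d =
      ∑ k ∈ range R, c (k - j₁) j₁ • f (k - j₁) j₁ • ∑ d ∈ range R, g (k - j₁) (d - j₁) • γ k d := by
    intro j₁
    have e3 : ∀ d : ℕ, ∑ i ∈ range R, (c i j₁ * (f i j₁ * g i (d - j₁))) • γ (i + j₁) d =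
        ∑ k ∈ range R, (c (k - j₁) j₁ * (f (k - j₁) j₁ * g (k - j₁) (d - j₁))) • γ k d := fun d =>
      sum_range_shift (f := fun i => c i j₁ * (f i j₁ * g i (d - j₁))) (g := fun k => γ k d) j₁
        (fun i hi => by simp only [hc i j₁ hi, zero_mul]) fun k hk => h1 _ _ hk
    simp only [smul_sum, ← mul_smul]
    rw [sum_comm, sum_congr rfl fun d _ => e3 d, sum_comm]
  rw [sum_congr rfl fun j₁ _ => e2 j₁, sum_comm]
  refine sum_congr rfl fun k _ => ?_
  simp only [smul_sum, sum_smul, ← mul_smul]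
  rw [sum_comm]

theorem hasseDeriv_bin_zero (h : ℕ) (α : ℤ) :
    LaurentSeries.hasseDeriv ℂ h (bin α 0) = ((Ring.choose α h : ℤ) : ℂ) • bin (α - h) 0 := by
  rw [hasseDeriv_bin, sum_range_succ, sum_eq_zero, zero_add]
  · simp
  · intro i hi
    have := mem_range.1 hi
    rw [Ring.choose_zero_pos _ (by lia), mul_zero, Int.cast_zero, LaurentSeries.zero_smul]

/-! ### The iterate formula and associativity modulo O'_{n,m}(V) -/

namespace VertexOperatorAlgebra

variable {V : Type*} [AddCommGroup V] [Module ℂ V] (A : VertexOperatorAlgebra V)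

theorem eventually_residue_bin (α β : ℤ) (u v : V) : ∀ᶠ H : ℕ in atTop,
    A.residue (bin α β) u v =
      ∑ h ∈ range H, ((Ring.choose α h : ℤ) : ℂ) • A.mode u (β + h) v := by
  have h1 : ∀ᶠ h : ℕ in atTop, Ring.choose α h • A.mode u (h - -β) v = 0 := by
    filter_upwards [A.eventually_mode_add_eq_zero u v β] with h hh
    rw [sub_neg_eq_add, add_comm, hh, smul_zero]
  filter_upwards [finsum_nat_eventually_eq h1] with H hH
  rw [residue_bin, res, hH]
  refine sum_congr rfl fun h _ => ?_
  rw [sub_neg_eq_add, add_comm, Int.cast_smul_eq_zsmul]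

/-- The class modulo `O'_{n,m}(V)` of the elementary products of two vertex operators. -/
def pairing (n m : ℕ) (k l : ℤ) (a b c : V) (r s : ℤ) : V ⧸ A.O' n m :=
  (A.O' n m).mkQ (A.residue (bin (k + m) r) a (A.residue (bin (l + m) s) b c))

theorem mkQ_eq_zero {n m : ℕ} {v : V} (hv : v ∈ A.O' n m) : (A.O' n m).mkQ v = 0 := by
  rwa [Submodule.mkQ_apply, Submodule.Quotient.mk_eq_zero]

theorem mkQ_eq_mkQ {n m : ℕ} {u v : V} (h : u - v ∈ A.O' n m) :
    (A.O' n m).mkQ u = (A.O' n m).mkQ v := by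
  rw [← sub_eq_zero, ← map_sub, A.mkQ_eq_zero h]

/-- Either the outer kernel is negligible by itself, or the two degrees together are. These two
vanishing regions make all later truncation lengths irrelevant. -/
theorem pairing_eq_zero {n m : ℕ} {k l : ℤ} {a b : V} (ha : a ∈ A.wt k) (hb : b ∈ A.wt l) (c : V)
    {r s : ℤ} (h : r ≤ -(n + m + 2) ∨ r + s ≤ -(n + 2 * m + 3)) :
    A.pairing n m k l a b c r s = 0 := by
  apply A.mkQ_eq_zero
  rcases h with h | h
  · exact A.residue_mem_O' ha (bin_mem_polarSpace le_rfl (by lia)) _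
  · exact A.residue_residue_mem_O' ha hb c (bin_mem_polarSpace le_rfl le_rfl)
      (bin_mem_polarSpace le_rfl le_rfl) (by lia)

theorem mkQ_residue_binTrunc (n m : ℕ) (k l : ℤ) (a b c : V) (r s α β : ℤ) (T T' : ℕ) :
    (A.O' n m).mkQ (A.residue (bin (k + m) r * binTrunc α T) a
      (A.residue (bin (l + m) s * binTrunc β T') b c)) =
    ∑ j₁ ∈ range T, ∑ j₂ ∈ range T', ((zchoose α j₁ : ℂ) * (zchoose β j₂ : ℂ)) •
      A.pairing n m k l a b c (r + α - j₁) (s + β - j₂) := by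
  simp only [binTrunc, mul_sum, mul_smul_comm, bin_mul_bin, add_zero, map_sum, map_smul,
    LinearMap.sum_apply, LinearMap.smul_apply, pairing, zchoose_natCast, add_sub_assoc, mul_smul,
    smul_sum]
  rw [sum_comm]
  exact sum_congr rfl fun _ _ => sum_congr rfl fun _ _ => smul_comm _ _ _

/-- The iterate side of the Jacobi identity. The h-th divided derivative of (1+y)^{k+q} carries the
coefficient (k+q choose h) of a_{-N+h}b, and multiplying it by `G` gives a shifted form of the
kernel of ∗_{m,q}^n. Replacing (1+y)^{k+q} by `F` costs nothing modulo O'. -/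
theorem mkQ_star_smul_mode (n m q : ℕ) {k l : ℤ} {a b : V} (ha : a ∈ A.wt k)
    (hb : b ∈ A.wt l)
    (c : V) {N : ℤ} {ρ ν : ℕ} (hν : (ν : ℤ) = N - 1 - q + ρ) {F G : ℂ⸨X⸩}
    (hG : G = bin (l + m + ν) 0 * binTrunc ((q : ℤ) - n - m - 1 - ρ) (q + 1))
    (hGmem : G ∈ polarSpace (l + m + ν) (l + N - n - 2))
    (hFsub : bin (k + q) 0 - F ∈ polarSpace (k + q) (k - 1)) (h : ℕ) :
    (A.O' n m).mkQ (A.star m q n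
      (((Ring.choose (k + q) h : ℤ) : ℂ) • A.mode a (-N + h) b) c) =
      (A.O' n m).mkQ
        (A.residue (LaurentSeries.hasseDeriv ℂ h F * G) (A.mode a (-N + h) b) c) := by
  have hW := A.mode_mem_wt ha hb (-N + h)
  have s1 := A.residue_shifted_sub_star_mem_O' m q n ρ (T := q + 1) (by lia) hW c
  have s2 : LaurentSeries.hasseDeriv ℂ h (bin (k + q) 0) * G =
      ((Ring.choose (k + q) h : ℤ) : ℂ) • (bin (k + l - (-N + h) - 1 + m + ρ) 0 *
        binTrunc ((q : ℤ) - n - m - 1 - ρ) (q + 1)) := by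
    rw [hasseDeriv_bin_zero, smul_mul_assoc, hG, ← mul_assoc, bin_mul_bin,
      show k + q - h + (l + m + ν) = k + l - (-N + h) - 1 + m + ρ by lia, add_zero]
  have s3 := A.residue_mem_O' hW (polarSpace_mono (α := k + l - (-N + h) - 1 + m)
    (β := k + l - (-N + h) - 1 - 2 - n) (by lia) (by lia)
    (mul_mem_polarSpace (hasseDeriv_mem_polarSpace hFsub h) hGmem)) c
  rw [map_sub, sub_mul, s2, map_sub, LinearMap.sub_apply, LinearMap.sub_apply] at s3
  rw [← A.mkQ_eq_mkQ s3]
  simp only [map_smul, LinearMap.smul_apply]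
  rw [A.mkQ_eq_mkQ s1]

/-- The product side. The order of `G` at -1 and its degree at ∞ make the terms with b outermost
negligible; in the remaining ones the shift by `ν` is undone. -/
theorem mkQ_jacobi_term (n m q : ℕ) {k l : ℤ} {a b : V} (ha : a ∈ A.wt k)
    (hb : b ∈ A.wt l)
    (c : V) {N : ℤ} {ρ ν : ℕ} (hν : (ν : ℤ) = N - 1 - q + ρ) {α β : ℤ} (hα : α = (q : ℤ) - m)
    (hβ : β = N - n - 2 - m) {F G : ℂ⸨X⸩} (hF : F = bin (k + m) 0 * binTrunc α (q + 1))
    (hG : G = bin (l + m + ν) 0 * binTrunc ((q : ℤ) - n - m - 1 - ρ) (q + 1))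
    (hGmem : G ∈ polarSpace (l + m + ν) (l + N - n - 2)) (i : ℕ) :
    (A.O' n m).mkQ ((((-1 : ℤ) ^ i * Ring.choose (-N) i : ℤ) : ℂ) •
        (A.residue (bin 0 (-N - i) * F) a (A.residue (bin 0 i * G) b c)
          - (-1 : ℂ) ^ (-N) • A.residue (bin 0 (-N - i) * G) b (A.residue (bin 0 i * F) a c))) =
      (negBinom N i : ℂ) • (A.O' n m).mkQ (A.residue (bin (k + m) (-N - i) * binTrunc α (q + 1)) a
        (A.residue (bin (l + m) i * binTrunc β (q + 1)) b c)) := by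
  rw [map_smul, map_sub, map_smul, negBinom_natCast]
  have s1 : A.residue (bin 0 (-N - i) * G) b (A.residue (bin 0 i * F) a c) ∈ A.O' n m :=
    A.residue_mem_O' hb (polarSpace_mono (by lia) (by lia) (mul_mem_polarSpace
      (bin_mem_polarSpace (α := 0) (β := -N - i) (α' := 0) (b := -N - i) (by lia) (by lia))
      hGmem)) _
  rw [A.mkQ_eq_zero s1, smul_zero, sub_zero]
  refine congrArg _ ?_
  have s2 : bin 0 (-N - i) * F = bin (k + m) (-N - i) * binTrunc α (q + 1) := by
    rw [hF, ← mul_assoc, bin_mul_bin, zero_add, add_zero]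
  rw [s2]
  apply A.mkQ_eq_mkQ
  rw [← map_sub, ← LinearMap.sub_apply, ← LinearMap.sub_apply, ← map_sub]
  have s3 := bin_natCast_mul_binTrunc_sub_mem_polarSpace ((q : ℤ) - n - m - 1 - ρ) ν
    (T := q + 1) (by lia)
  rw [show (q : ℤ) - n - m - 1 - ρ + ν = β by lia] at s3
  have s4 := mul_mem_polarSpace (bin_mem_polarSpace (α := l + m) (β := l + m + i) (b := i)
    le_rfl (by lia)) s3
  rw [mul_sub, ← mul_assoc, bin_mul_bin] at s4
  have s5 : bin 0 i * G = bin (l + m + ν) (i + 0) *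
      binTrunc ((q : ℤ) - n - m - 1 - ρ) (q + 1) := by
    rw [hG, ← mul_assoc, bin_mul_bin, zero_add]
  rw [s5]
  have s6 := mul_mem_polarSpace (bin_mem_polarSpace (α := k + m)
    (β := k + m - N - i) (b := -N - i) le_rfl (by lia)) (binTrunc_mem_polarSpace α (q + 1))
  rw [add_zero (l + (m : ℤ))] at s4
  rw [add_zero (k + (m : ℤ))] at s6
  exact A.residue_residue_mem_O' ha hb c s6 s4 (by push_cast; lia)

theorem eventually_mkQ_star_residue (n m q : ℕ) {k l : ℤ} {a b : V} (ha : a ∈ A.wt k)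
    (hb : b ∈ A.wt l)
    (c : V) (N : ℤ) : ∀ᶠ H : ℕ in atTop,
    (A.O' n m).mkQ (A.star m q n (A.residue (bin (k + q) (-N)) a b) c) =
      ∑ i ∈ range H, (negBinom N i : ℂ) • (A.O' n m).mkQ (A.residue
        (bin (k + m) (-N - i) * binTrunc ((q : ℤ) - m) (q + 1)) a
          (A.residue (bin (l + m) i * binTrunc (N - n - 2 - m) (q + 1)) b c)) := by
  -- The weight k+l+N-h-1 of a_{-N+h}b forces ν = N-1-q+ρ; the shift ρ is there to make ν
  -- nonnegative.
  obtain ⟨ρ, ν, hν⟩ : ∃ ρ ν : ℕ, (ν : ℤ) = N - 1 - q + ρ :=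
    ⟨((q : ℤ) + 1 - N).toNat, (N - 1 - q + ((q : ℤ) + 1 - N).toNat).toNat, by lia⟩
  set α : ℤ := (q : ℤ) - m with hα
  set β : ℤ := N - n - 2 - m with hβ
  set F : ℂ⸨X⸩ := bin (k + m) 0 * binTrunc α (q + 1) with hF
  set G : ℂ⸨X⸩ := bin (l + m + ν) 0 * binTrunc ((q : ℤ) - n - m - 1 - ρ) (q + 1) with hG
  have hGmem : G ∈ polarSpace (l + m + ν) (l + N - n - 2) :=
    polarSpace_mono (by lia) (by lia) (mul_mem_polarSpace (bin_mem_polarSpace (α := l + m + ν)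
      (β := l + m + ν) (b := 0) le_rfl (by lia))
      (binTrunc_mem_polarSpace ((q : ℤ) - n - m - 1 - ρ) (q + 1)))
  have hFsub : bin (k + q) 0 - F ∈ polarSpace (k + q) (k - 1) := by
    have h1 := mul_mem_polarSpace (bin_mem_polarSpace (α := k + m) (β := k + m) (b := 0) le_rfl
      (by lia)) (bin_sub_binTrunc_mem_polarSpace α (T := q + 1) (by lia) (by push_cast; lia))
    rw [mul_sub, bin_mul_bin, add_zero, show k + m + α = k + q by lia, ← hF] at h1
    exact polarSpace_mono le_rfl (by push_cast; lia) h1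
  filter_upwards [A.eventually_residue_bin (k + q) (-N) a b, A.jacobiHolds a b c (-N) F G]
    with H hres hJ
  rw [hres, map_sum, LinearMap.sum_apply, map_sum, sum_congr rfl fun h _ =>
    A.mkQ_star_smul_mode n m q ha hb c hν hG hGmem hFsub h,
    ← map_sum, hJ, map_sum, sum_congr rfl fun i _ =>
    A.mkQ_jacobi_term n m q ha hb c hν hα hβ hF hG hGmem i]

/-- The iterate formula. -/
theorem mkQ_star_residue (n m q : ℕ) {k l : ℤ} {a b : V} (ha : a ∈ A.wt k)
    (hb : b ∈ A.wt l)
    (c : V) (N : ℤ) :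
    (A.O' n m).mkQ (A.star m q n (A.residue (bin (k + q) (-N)) a b) c) =
      ∑ i ∈ range ((n : ℤ) + q + 2 - N).toNat, (negBinom N i : ℂ) •
        (A.O' n m).mkQ (A.star m ((n : ℤ) + q + 1 - N - i).toNat n a
          (A.star m q ((n : ℤ) + q + 1 - N - i).toNat b c)) := by
  have hH₀ : ∀ᶠ H : ℕ in atTop, (n : ℤ) + q + 2 - N ≤ H :=
    tendsto_natCast_atTop_atTop.eventually_ge_atTop _
  obtain ⟨H, hI, hqH, hlhs₀⟩ := (hH₀.and ((eventually_gt_atTop q).and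
    (A.eventually_mkQ_star_residue n m q ha hb c N))).exists
  set α : ℤ := (q : ℤ) - m with hα
  set β : ℤ := N - n - 2 - m with hβ
  -- Both sides are expanded in the same elementary products, indexed by K = i+j₁ and d = j₁+j₂.
  -- They vanish for K ≥ n+q+2-N or d > q, so every sum may run up to a common `H`.
  set γ : ℕ → ℕ → V ⧸ A.O' n m := fun K d =>
    A.pairing n m k l a b c (α - N - K) (β + K - d) with hγ
  have hγ₁ : ∀ K d : ℕ, (n : ℤ) + q + 2 - N ≤ K → γ K d = 0 := fun K d h =>
    A.pairing_eq_zero ha hb c (by lia)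
  have hγ₂ : ∀ K d : ℕ, q < d → γ K d = 0 := fun K d h => A.pairing_eq_zero ha hb c (by lia)
  have hlhs : ∀ i : ℕ, (negBinom N i : ℂ) • (A.O' n m).mkQ (A.residue
      (bin (k + m) (-N - i) * binTrunc α (q + 1)) a
        (A.residue (bin (l + m) i * binTrunc β (q + 1)) b c)) =
      ∑ j₁ ∈ range H, ∑ j₂ ∈ range H, ((negBinom N i : ℂ) *
        ((zchoose α j₁ : ℂ) * (zchoose β j₂ : ℂ))) • γ (i + j₁) (j₁ + j₂) := by
    intro i
    rw [mkQ_residue_binTrunc, smul_sum]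
    refine sum_subset_zero_on_sdiff (range_mono hqH) (fun j₁ hj₁ => ?_) fun j₁ _ => ?_
    · refine sum_eq_zero fun j₂ _ => ?_
      rw [Finset.mem_sdiff, mem_range, mem_range] at hj₁
      rw [hγ₂ _ _ (by lia), smul_zero]
    · rw [smul_sum]
      refine sum_subset_zero_on_sdiff (range_mono hqH) (fun j₂ hj₂ => ?_) fun j₂ _ => ?_
      · rw [Finset.mem_sdiff, mem_range, mem_range] at hj₂
        rw [hγ₂ _ _ (by lia), smul_zero]
      · simp only [hγ]
        rw [smul_smul, show -N - i + α - j₁ = α - N - (i + j₁ : ℕ) by push_cast; ring,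
          show i + β - j₂ = β + (i + j₁ : ℕ) - (j₁ + j₂ : ℕ) by push_cast; ring]
  have hrhs : ∑ i ∈ range ((n : ℤ) + q + 2 - N).toNat, (negBinom N i : ℂ) •
        (A.O' n m).mkQ (A.star m ((n : ℤ) + q + 1 - N - i).toNat n a
          (A.star m q ((n : ℤ) + q + 1 - N - i).toNat b c)) =
      ∑ i ∈ range H, ∑ j₁ ∈ range H, ∑ j₂ ∈ range H, ((negBinom N i : ℂ) *
        ((zchoose (α - N - i) j₁ : ℂ) * (zchoose (β + i) j₂ : ℂ))) • γ (i + j₁) (j₁ + j₂) := by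
    refine sum_subset_zero_on_sdiff (range_mono (by lia)) (fun i hi => ?_) fun i hi => ?_
    · refine sum_eq_zero fun j₁ _ => sum_eq_zero fun j₂ _ => ?_
      rw [Finset.mem_sdiff, mem_range, mem_range] at hi
      rw [hγ₁ _ _ (by push_cast; lia), smul_zero]
    · rw [mem_range] at hi
      obtain ⟨p, hp⟩ : ∃ p : ℕ, (n : ℤ) + q + 1 - N - i = p :=
        ⟨((n : ℤ) + q + 1 - N - i).toNat, by lia⟩
      rw [hp, Int.toNat_natCast, A.star_of_mem_wt _ _ _ ha, A.star_of_mem_wt _ _ _ hb, starFun,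
        starFun, mkQ_residue_binTrunc, smul_sum,
        show (p : ℤ) - n - m - 1 = α - N - i by lia, show (q : ℤ) - p - m - 1 = β + i by lia]
      refine sum_subset_zero_on_sdiff (range_mono (by lia)) (fun j₁ hj₁ => ?_) fun j₁ _ => ?_
      · refine sum_eq_zero fun j₂ _ => ?_
        rw [Finset.mem_sdiff, mem_range, mem_range] at hj₁
        rw [hγ₁ _ _ (by push_cast; lia), smul_zero]
      · rw [smul_sum]
        refine sum_subset_zero_on_sdiff (range_mono hqH) (fun j₂ hj₂ => ?_) fun j₂ _ => ?_
        · rw [Finset.mem_sdiff, mem_range, mem_range] at hj₂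
          rw [hγ₂ _ _ (by lia), smul_zero]
        · simp only [hγ]
          rw [smul_smul, show 0 + (α - N - i) - j₁ = α - N - (i + j₁ : ℕ) by push_cast; ring,
            show 0 + (β + i) - j₂ = β + (i + j₁ : ℕ) - (j₁ + j₂ : ℕ) by push_cast; ring]
  rw [hrhs, hlhs₀, sum_congr rfl fun i _ => hlhs i]
  have hneg : ∀ i : ℤ, i < 0 → (negBinom N i : ℂ) = 0 := fun i hi => by
    rw [negBinom, zchoose_of_neg _ hi, Int.cast_zero]
  rw [sum_sum_sum_shift (c := fun i _ => (negBinom N i : ℂ)) (f := fun _ j => (zchoose α j : ℂ))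
      (g := fun _ j => (zchoose β j : ℂ)) (fun i _ hi => hneg i hi)
      (fun _ j hj => by simp [zchoose_of_neg _ hj])
      (fun K d h => hγ₁ K d (by lia)) (fun K d h => hγ₂ K d (by lia)),
    sum_sum_sum_shift (c := fun i _ => (negBinom N i : ℂ))
      (f := fun i j => (zchoose (α - N - i) j : ℂ))
      (g := fun i j => (zchoose (β + i) j : ℂ)) (fun i _ hi => hneg i hi)
      (fun _ j hj => by simp [zchoose_of_neg _ hj])
      (fun K d h => hγ₁ K d (by lia)) (fun K d h => hγ₂ K d (by lia))]
  refine sum_congr rfl fun K _ => sum_congr rfl fun d hd => ?_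
  congr 1
  -- It remains to compare the coefficients of each γ K d.
  have := congrArg (Int.cast : ℤ → ℂ)
    (sum_negBinom_mul_zchoose α β N K (d := d) (R := H) (by have := mem_range.1 hd; lia))
  push_cast at this
  rw [this]
  refine sum_congr rfl fun j _ => ?_
  rw [show α - N - (K - j : ℤ) = α - N - K + j by ring, show β + (K - j : ℤ) = β + K - j by ring]

/-- For a ∘ b the iterate formula is used with N = n+p+2, where its sum is empty. For the generators
involving L(-1), integration by parts leads to a negligible kernel. -/
theorem star_mem_O'_of_left_mem (m p n : ℕ) {w : V} (hw : w ∈ A.O' n p) (c : V) :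
    A.star m p n w c ∈ A.O' n m := by
  induction hw using Submodule.span_induction with
  | zero => simp
  | add x y _ _ hx hy => rw [map_add, LinearMap.add_apply]; exact add_mem hx hy
  | smul r x _ hx => rw [map_smul, LinearMap.smul_apply]; exact Submodule.smul_mem _ r hx
  | mem w hw =>
    rcases hw with ⟨k, a, ha, b, rfl⟩ | ⟨b, rfl⟩
    · rw [← neg_neg ((n : ℤ) + p + 2), ← residue_bin, ← Submodule.Quotient.mk_eq_zero,
        ← Submodule.mkQ_apply]
      induction b using A.wt_induction with
      | hadd u v hu hv => rw [map_add, map_add, LinearMap.add_apply, map_add, hu, hv, add_zero]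
      | hwt l b hb =>
        rw [A.mkQ_star_residue n m p ha hb, sub_self, Int.toNat_zero, sum_range_zero]
    · induction b using A.wt_induction with
      | hadd u v hu hv =>
        convert add_mem hu hv using 1
        simp only [map_add, smul_add, LinearMap.add_apply]
        abel
      | hwt k b hb =>
        have h1 := A.residue_mem_O' hb (hasseDeriv_starFun_mem_polarSpace m p n k) c
        have h2 : starFun m p n (k + 1) = bin 1 0 * starFun m p n k := by
          rw [starFun, starFun, ← mul_assoc, bin_mul_bin, add_zero]
          ring_nf
        rw [A.L_zero_apply hb]
        simp only [map_add, map_smul, LinearMap.add_apply, LinearMap.smul_apply]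
        rw [A.star_of_mem_wt _ _ _ hb, A.star_of_mem_wt _ _ _ (A.L_neg_one_mem_wt hb),
          residue_L_neg_one, h2]
        convert h1 using 1
        simp only [map_sub, map_smul, LinearMap.sub_apply, LinearMap.smul_apply]
        module

/-- Associativity of the products `∗_{m,p}^n` modulo `O'_{n,m}(V)`. -/
theorem star_assoc_mem_O' (n m p q : ℕ) (a b c : V) :
    A.star m q n (A.star q p n a b) c - A.star m p n a (A.star m q p b c) ∈ A.O' n m := by
  rw [← Submodule.Quotient.mk_eq_zero, ← Submodule.mkQ_apply, map_sub, sub_eq_zero]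
  induction a using A.wt_induction with
  | hadd u v hu hv => simp only [map_add, LinearMap.add_apply, hu, hv]
  | hwt k a ha =>
  induction b using A.wt_induction with
  | hadd u v hu hv => simp only [map_add, LinearMap.add_apply, hu, hv]
  | hwt l b hb =>
  set N : ℤ := (n : ℤ) + q + 1 - p with hN
  set X : ℕ → V ⧸ A.O' n m := fun i =>
    (A.O' n m).mkQ (A.star m (p - i) n a (A.star m q (p - i) b c)) with hX
  -- a ∗_{q,p}^n b is a combination of residues with pole orders N+j; the iterate formula is applied
  -- to each of them.
  have e1 : ∀ j ∈ range (p + 1), (A.O' n m).mkQ (A.star m q n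
      (((Ring.choose (-N) j : ℤ) : ℂ) • A.residue (bin (k + q) (-(N + j))) a b) c) =
      ∑ i ∈ range (p + 1 - j), ((zchoose (-N) j * zchoose (N + (i + j : ℕ) - 1) i : ℤ) : ℂ) •
        X (i + j) := by
    intro j hj
    have hj' := mem_range.1 hj
    rw [map_smul, LinearMap.smul_apply, map_smul, A.mkQ_star_residue n m q ha hb, smul_sum,
      show ((n : ℤ) + q + 2 - (N + j)).toNat = p + 1 - j by lia]
    refine sum_congr rfl fun i hi => ?_
    have hi' := mem_range.1 hi
    rw [show ((n : ℤ) + q + 1 - (N + j) - i).toNat = p - (i + j) by lia, smul_smul,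
      zchoose_natCast, negBinom]
    push_cast
    rw [show N + j - 1 + (i : ℤ) = N + (i + j) - 1 by ring]
  rw [A.star_of_mem_wt _ _ _ ha, starFun, binTrunc, show (p : ℤ) - n - q - 1 = -N by lia]
  simp only [mul_sum, mul_smul_comm, bin_mul_bin, zero_add, add_zero, map_sum, map_smul,
    LinearMap.sum_apply, LinearMap.smul_apply]
  simp only [map_smul, LinearMap.smul_apply] at e1
  simp only [show ∀ j : ℕ, -N - (j : ℤ) = -(N + j) from fun j => by ring]
  rw [sum_congr rfl e1]
  have e2 := Finset.sum_range_diag_flip (p + 1) fun j i =>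
    ((zchoose (-N) j * zchoose (N + (i + j : ℕ) - 1) i : ℤ) : ℂ) • X (i + j)
  rw [← e2, sum_range_succ', sum_eq_zero, zero_add]
  · simp [hX, zchoose_zero_right]
  · intro s _
    -- By Vandermonde the total coefficient of X (s+1) is (s choose s+1) = 0, so only X 0 remains.
    have e3 := zchoose_vandermonde (-N) (N + (s + 1 : ℕ) - 1) (s + 1)
    rw [show -N + (N + ((s + 1 : ℕ) : ℤ) - 1) = (s : ℕ) by push_cast; ring, zchoose_natCast,
      choose_natCast_eq_zero (by lia)] at e3
    have e4 : ∀ j ∈ range (s + 1 + 1),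
        ((zchoose (-N) j * zchoose (N + (s + 1 - j + j : ℕ) - 1) (s + 1 - j : ℕ) : ℤ) : ℂ) •
          X (s + 1 - j + j) =
        ((zchoose (-N) j * zchoose (N + (s + 1 : ℕ) - 1) ((s + 1 : ℕ) - j) : ℤ) : ℂ) •
          X (s + 1) := by
      intro j hj
      have := mem_range.1 hj
      rw [Nat.sub_add_cancel (by lia), Nat.cast_sub (by lia)]
    rw [sum_congr rfl e4, ← sum_smul, ← Int.cast_sum, ← e3, Int.cast_zero, zero_smul]

/-! ### The vacuum as a two-sided identity, and O = O' -/

theorem residue_vacuum (f : ℂ⸨X⸩) (v : V) : A.residue f A.vacuum v = f.coeff (-1) • v := by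
  rw [residue_apply, finsum_eq_single _ (-1)]
  · rw [mode_vacuum, if_pos rfl]
  · intro j hj
    rw [mode_vacuum, if_neg hj, smul_zero]

/-- Only the leading term of the truncation reaches z^{-1}. -/
theorem coeff_bin_mul_binTrunc (m T : ℕ) :
    (bin m 0 * binTrunc (-m - 1) (T + 1)).coeff (-1) = 1 := by
  simp only [binTrunc, mul_sum, mul_smul_comm, bin_mul_bin, add_zero, zero_add,
    HahnSeries.coeff_sum, HahnSeries.coeff_smul, coeff_bin]
  rw [sum_range_succ', sum_eq_zero]
  · rw [Ring.choose_zero_right, show -1 - (-(m : ℤ) - 1 - (0 : ℕ)) = (m : ℕ) by push_cast; ring,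
      zchoose_natCast, Ring.choose_natCast, Nat.choose_self]
    simp
  · intro i _
    rw [show -1 - (-(m : ℤ) - 1 - (i + 1 : ℕ)) = (m + (i + 1) : ℕ) by push_cast; ring,
      zchoose_natCast, choose_natCast_eq_zero (by lia)]
    simp

theorem star_vacuum_left (m n : ℕ) (v : V) : A.star m n n A.vacuum v = v := by
  rw [A.star_of_mem_wt _ _ _ A.vacuum_mem, residue_vacuum, starFun,
    show (n : ℤ) - n - m - 1 = -m - 1 by ring, zero_add, coeff_bin_mul_binTrunc, one_smul]

/-- Modulo O', L(-1) acts on weight k as n-m-k, hence Y(v,z)𝟏 = e^{zL(-1)}v becomes (1+z)^{n-m-k}v.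
-/
theorem mkQ_mode_vacuum (n m : ℕ) {k : ℤ} {v : V} (hv : v ∈ A.wt k) (j : ℤ) :
    (A.O' n m).mkQ (A.mode v j A.vacuum) =
      (zchoose ((n : ℤ) - m - k) (-1 - j) : ℂ) • (A.O' n m).mkQ v := by
  rcases lt_or_ge (-1 - j) 0 with h | h
  · rw [zchoose_of_neg _ h, Int.cast_zero, zero_smul]
    have : A.mode v j A.vacuum = 0 := A.mode_vacuum_nonneg v j (by lia)
    rw [this, map_zero]
  · obtain ⟨i, hi⟩ : ∃ i : ℕ, -1 - j = i := ⟨(-1 - j).toNat, by lia⟩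
    obtain rfl : j = -1 - i := by lia
    clear h
    rw [hi, zchoose_natCast]
    clear hi
    induction i generalizing k v with
    | zero =>
      have : A.mode v (-1) A.vacuum = v := A.mode_vacuum_neg_one v
      simp [this]
    | succ i ih =>
      have h1 := ih (A.L_neg_one_mem_wt hv)
      rw [mode_L_neg_one, map_smul] at h1
      have h2 := A.mkQ_eq_zero (A.L_neg_one_add_smul_mem_O' n m hv)
      rw [map_add, map_smul, add_eq_zero_iff_eq_neg] at h2
      rw [h2] at h1
      have h3 := choose_mul_choose_add ((n : ℤ) - m - k) i 1
      simp only [Nat.cast_one, Ring.choose_one_right] at h3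
      have h4 := congrArg (Int.cast : ℤ → ℂ) h3
      push_cast at h4
      have h5 : (i + 1 : ℂ) ≠ 0 := by exact_mod_cast Nat.succ_ne_zero i
      rw [show -1 - (i : ℤ) - 1 = -1 - (i + 1 : ℕ) by push_cast; ring,
        show (n : ℤ) - m - (k + 1) = n - m - k - 1 by ring] at h1
      refine smul_right_injective _ h5 ?_
      simp only []
      rw [smul_smul, h4]
      push_cast at h1 ⊢
      rw [show (i + 1 : ℂ) = -(-1 - i) by ring, h1]
      module

theorem residue_bin_eq_sum {u v : V} (α : ℤ) {β : ℤ} {H : ℕ}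
    (hH : ∀ t ≥ β + H, A.mode u t v = 0) : A.residue (bin α β) u v =
      ∑ h ∈ range H, (zchoose α h : ℂ) • A.mode u (β + h) v := by
  obtain ⟨H', h', hH'⟩ := ((A.eventually_residue_bin α β u v).and (eventually_ge_atTop H)).exists
  rw [h', ← sum_range_add_sum_Ico _ hH', sum_eq_zero (s := Ico _ _) fun i hi => ?_, add_zero]
  · simp only [zchoose_natCast]
  · rw [hH _ (by have := (mem_Ico.1 hi).1; lia), smul_zero]

theorem star_vacuum_right_sub_mem_O' (m n : ℕ) (v : V) :
    A.star m m n v A.vacuum - v ∈ A.O' n m := by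
  rw [← Submodule.Quotient.mk_eq_zero, ← Submodule.mkQ_apply, map_sub, sub_eq_zero]
  induction v using A.wt_induction with
  | hadd u v hu hv => rw [map_add, LinearMap.add_apply, map_add, hu, hv, map_add]
  | hwt k v hv =>
    -- The factor (1+z)^{n-m-k} turns the exponent k+m of the kernel into n, and
    -- `coeff_bin_mul_binTrunc` applies with n in the role of m.
    have h1 : ∀ α β : ℤ, (A.O' n m).mkQ (A.residue (bin α β) v A.vacuum) =
        (bin (α + ((n : ℤ) - m - k)) β).coeff (-1) • (A.O' n m).mkQ v := by
      intro α β
      rw [A.residue_bin_eq_sum α (H := (-1 - β).toNat + 1)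
        fun t ht => A.mode_vacuum_nonneg v t (by lia), map_sum, coeff_bin]
      simp only [map_smul, A.mkQ_mode_vacuum n m hv, smul_smul]
      rw [← sum_smul]
      congr 1
      rcases lt_or_ge (-1 - β) 0 with h | h
      · rw [zchoose_of_neg _ h, Int.cast_zero]
        refine sum_eq_zero fun i _ => ?_
        rw [zchoose_of_neg _ (j := -1 - (β + i)) (by lia), Int.cast_zero, mul_zero]
      · obtain ⟨t, ht⟩ : ∃ t : ℕ, -1 - β = t := ⟨(-1 - β).toNat, by lia⟩
        rw [ht, zchoose_vandermonde, Int.toNat_natCast]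
        push_cast
        refine sum_congr rfl fun i _ => ?_
        rw [← ht, show -1 - (β + (i : ℤ)) = -1 - β - i by ring]
    have h2 := coeff_bin_mul_binTrunc n m
    rw [A.star_of_mem_wt _ _ _ hv, starFun, show (m : ℤ) - n - m - 1 = -n - 1 by ring]
    simp only [binTrunc, mul_sum, mul_smul_comm, bin_mul_bin, add_zero, zero_add,
      HahnSeries.coeff_sum, HahnSeries.coeff_smul, smul_eq_mul] at h2
    simp only [binTrunc, mul_sum, mul_smul_comm, bin_mul_bin, add_zero, zero_add, map_sum,
      map_smul, LinearMap.sum_apply, LinearMap.smul_apply, h1, smul_smul,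
      show k + (m : ℤ) + ((n : ℤ) - m - k) = n by ring]
    rw [← sum_smul, h2, one_smul]

/-- O'' consists of products with associators and O''' of products with elements of O';
associativity and the stability of O' on both sides absorb them. -/
theorem O_eq_O' (n m : ℕ) : A.O n m = A.O' n m := by
  refine le_antisymm (sup_le (sup_le le_rfl (Submodule.span_le.2 ?_)) (Submodule.span_le.2 ?_))
    (le_sup_of_le_left le_sup_left)
  · rintro _ ⟨a, b, c, u, p₁, p₂, p₃, rfl⟩
    exact A.star_mem_O'_of_right_mem m p₃ n u (A.star_assoc_mem_O' p₃ m p₂ p₁ a b c)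
  · rintro _ ⟨p, u, w, v, hw, rfl⟩
    exact A.star_mem_O'_of_left_mem m p n (A.star_mem_O'_of_right_mem p p n u hw) v

/-! ### The involution φ and its action on residues -/

theorem zchoose_neg_one_pow (a : ℤ) (i : ℕ) :
    zchoose a i = (-1) ^ i * zchoose (i - a - 1) i := by
  have h := negBinom_natCast (-a) i
  rw [negBinom, neg_neg, show -a - 1 + (i : ℤ) = i - a - 1 by ring] at h
  rw [h, ← mul_assoc, ← mul_pow, neg_one_mul, neg_neg, one_pow, one_mul, zchoose_natCast]

/-- With z^t in place of g t this reads (1+z)^e (1 - z/(1+z))^α = (1+z)^{e-α}. It carries out the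
substitution z ↦ -z/(1+z) on coefficients. -/
theorem sum_range_flip {M : Type*} [AddCommGroup M] [Module ℂ M] (α e : ℤ) {g : ℕ → M} {R : ℕ}
    (hg : ∀ t ≥ R, g t = 0) :
    ∑ h ∈ range R, ((-1) ^ h * zchoose α h : ℂ) •
        ∑ i ∈ range R, (zchoose (e - h) i : ℂ) • g (h + i) =
      ∑ t ∈ range R, (zchoose (e - α) t : ℂ) • g t := by
  have h1 : ∀ h ∈ range R, ∑ i ∈ range R, (zchoose (e - h) i : ℂ) • g (h + i) =
      ∑ t ∈ range R, (zchoose (e - h) ((t : ℤ) - h) : ℂ) • g t := by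
    intro h _
    have := sum_range_shift (f := fun i => (zchoose (e - h) i : ℂ)) (g := g) (R := R) (j := h)
      (fun i hi => by simp only [zchoose_of_neg _ hi, Int.cast_zero]) hg
    simp only [← this, add_comm h]
  rw [sum_congr rfl fun h hh => by rw [h1 h hh]]
  simp only [smul_sum, smul_smul]
  rw [sum_comm]
  refine sum_congr rfl fun t ht => ?_
  rw [← sum_smul]
  congr 1
  have h2 := zchoose_vandermonde α (t - e - 1) t
  rw [zchoose_neg_one_pow, show (t : ℤ) - (e - α) - 1 = α + (t - e - 1) by ring, h2,
    ← sum_subset (range_subset_range.2 (mem_range.1 ht))]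
  · push_cast
    rw [mul_sum]
    refine sum_congr rfl fun h hh => ?_
    obtain ⟨i, rfl⟩ := Nat.exists_eq_add_of_le (Nat.lt_succ_iff.1 (mem_range.1 hh))
    have h3 := zchoose_neg_one_pow (e - h) i
    rw [show (i : ℤ) - (e - h) - 1 = (h + i : ℕ) - e - 1 by push_cast; ring] at h3
    rw [show ((h + i : ℕ) : ℤ) - h = i by push_cast; ring, h3]
    push_cast
    rw [pow_add]
    ring
  · intro h _ hh
    rw [zchoose_of_neg _ (j := (t : ℤ) - h) (by have := mem_range.not.1 hh; lia), Int.cast_zero,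
      mul_zero]

/-- The divided power `L(1)^s / s!`, zero for negative `s`. -/
def dividedL (s : ℤ) : Module.End ℂ V :=
  if 0 ≤ s then ((s.toNat.factorial : ℂ)⁻¹) • A.L 1 ^ s.toNat else 0

theorem dividedL_natCast (s : ℕ) : A.dividedL s = ((s.factorial : ℂ)⁻¹) • A.L 1 ^ s := by
  simp [dividedL]

theorem dividedL_of_neg {s : ℤ} (hs : s < 0) : A.dividedL s = 0 := if_neg (by lia)

theorem dividedL_zero : A.dividedL 0 = 1 := by
  simp [dividedL]

theorem L_one_dividedL (s : ℤ) (v : V) :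
    A.L 1 (A.dividedL s v) = ((s : ℂ) + 1) • A.dividedL (s + 1) v := by
  rcases lt_trichotomy s (-1) with h | rfl | h
  · rw [A.dividedL_of_neg (by lia), A.dividedL_of_neg (by lia)]
    simp
  · rw [A.dividedL_of_neg (by lia)]
    simp
  · obtain ⟨s, rfl⟩ := Int.eq_ofNat_of_zero_le (show 0 ≤ s by lia)
    have h5 : (s + 1 : ℂ) ≠ 0 := by exact_mod_cast Nat.succ_ne_zero s
    rw [show (s : ℤ) + 1 = (s + 1 : ℕ) by push_cast; ring, dividedL_natCast, dividedL_natCast,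
      Nat.factorial_succ, pow_succ']
    simp only [LinearMap.smul_apply, map_smul, smul_smul, Module.End.mul_apply]
    push_cast
    congr 1
    field_simp

theorem dividedL_mem_wt {k : ℤ} {v : V} (hv : v ∈ A.wt k) (s : ℕ) :
    A.dividedL s v ∈ A.wt (k - s) := by
  rw [dividedL_natCast]
  refine Submodule.smul_mem _ _ ?_
  induction s with
  | zero => simpa using hv
  | succ s ih =>
    rw [pow_succ', Module.End.mul_apply]
    have := A.L_one_mem_wt ih
    rwa [show k - (s : ℤ) - 1 = k - (s + 1 : ℕ) by push_cast; ring] at this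

theorem exists_dividedL_eq_zero (v : V) : ∃ S : ℕ, ∀ s : ℤ, S ≤ s → A.dividedL s v = 0 := by
  induction v using A.wt_induction with
  | hadd u v hu hv =>
    obtain ⟨S, hS⟩ := hu
    obtain ⟨T, hT⟩ := hv
    refine ⟨max S T, fun s hs => ?_⟩
    rw [map_add, hS s (by lia), hT s (by lia), add_zero]
  | hwt k v hv =>
    obtain ⟨N, hN⟩ := A.wt_eq_bot
    refine ⟨(k - N + 1).toNat, fun s hs => ?_⟩
    obtain ⟨s, rfl⟩ := Int.eq_ofNat_of_zero_le (show 0 ≤ s by lia)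
    have := A.dividedL_mem_wt hv s
    rwa [hN _ (by lia), Submodule.mem_bot] at this

/-- The component form of conjugating Y(u,z) by e^{L(1)}. Induction on `M` by `L_one_mode`; the
coefficients match by Pascal's rule and absorption. -/
theorem dividedL_mode {k : ℤ} {u : V} (hu : u ∈ A.wt k) (j : ℤ) (v : V) {Q : ℕ} (M : ℕ)
    (hM : M < Q) : A.dividedL M (A.mode u j v) =
      ∑ i ∈ range Q, ∑ s ∈ range Q, (zchoose (2 * k - j - 2 - s) i : ℂ) •
        A.mode (A.dividedL s u) (j + i) (A.dividedL ((M : ℤ) - i - s) v) := by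
  induction M with
  | zero =>
    rw [sum_eq_single_of_mem 0 (mem_range.2 hM), sum_eq_single_of_mem 0 (mem_range.2 hM)]
    · simp [dividedL_zero, zchoose_zero_right]
    · intro s _ hs
      rw [A.dividedL_of_neg (s := ((0 : ℕ) : ℤ) - (0 : ℕ) - s) (by lia)]
      simp
    · intro i _ hi
      refine sum_eq_zero fun s _ => ?_
      rw [A.dividedL_of_neg (s := ((0 : ℕ) : ℤ) - i - s) (by lia)]
      simp
  | succ M ih =>
    have h5 : (M + 1 : ℂ) ≠ 0 := by exact_mod_cast Nat.succ_ne_zero M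
    refine smul_right_injective _ h5 ?_
    have h1 := A.L_one_dividedL M (A.mode u j v)
    rw [ih (by lia)] at h1
    simp only [Int.cast_natCast] at h1
    simp only [Nat.cast_succ]
    rw [← h1]
    simp only [map_sum, map_smul]
    set e : ℤ := 2 * k - j - 2 with he
    set B : ℕ → ℕ → V := fun i s =>
      A.mode (A.dividedL s u) (j + i) (A.dividedL ((M : ℤ) + 1 - i - s) v) with hB
    have hB0 : ∀ i s, M + 1 < i + s → B i s = 0 := by
      intro i s h
      simp only [hB]
      rw [A.dividedL_of_neg (s := (M : ℤ) + 1 - i - s) (by lia), LinearMap.zero_apply, map_zero]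
    have h2 : ∀ i s : ℕ, (zchoose (e - s) i : ℂ) • A.L 1 (A.mode (A.dividedL s u) (j + i)
        (A.dividedL ((M : ℤ) - i - s) v)) =
        ((M + 1 - i - s) * zchoose (e - s) i : ℂ) • B i s +
        (((s + 1 : ℕ) : ℂ) * zchoose (e - (s + 1 : ℕ) + 1) i) • B i (s + 1) +
        ((e - 2 * s - (i + 1 : ℕ) + 1) * zchoose (e - s) ((i + 1 : ℕ) - 1) : ℂ) • B (i + 1) s := by
      intro i s
      rw [L_one_mode, L_one_dividedL, L_one_dividedL, A.L_zero_apply (A.dividedL_mem_wt hu s)]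
      simp only [hB, map_smul, mode_smul_left, LinearMap.smul_apply]
      push_cast
      rw [show (M : ℤ) - i - s + 1 = M + 1 - i - s by ring,
        show (M : ℤ) + 1 - (i + 1) - s = M - i - s by ring,
        show (M : ℤ) + 1 - i - (s + 1) = M - i - s by ring,
        show j + ((i : ℤ) + 1) = j + i + 1 by ring, show e - ((s : ℤ) + 1) + 1 = e - s by ring,
        add_sub_cancel_right, he]
      push_cast
      module
    have h3 : ∀ i : ℕ, ∑ s ∈ range Q, (((s + 1 : ℕ) : ℂ) * zchoose (e - (s + 1 : ℕ) + 1) i) •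
        B i (s + 1) = ∑ s ∈ range Q, ((s : ℂ) * zchoose (e - s + 1) i) • B i s := by
      intro i
      have := sum_range_succ' (fun s : ℕ => ((s : ℂ) * zchoose (e - s + 1) i) • B i s) Q
      rw [sum_range_succ, hB0 i Q (by lia)] at this
      simpa using this.symm
    have h4 : ∀ s : ℕ, ∑ i ∈ range Q,
        ((e - 2 * s - (i + 1 : ℕ) + 1) * zchoose (e - s) ((i + 1 : ℕ) - 1) : ℂ) • B (i + 1) s =
        ∑ i ∈ range Q, ((e - 2 * s - i + 1) * zchoose (e - s) (i - 1) : ℂ) • B i s := by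
      intro s
      have := sum_range_succ'
        (fun i : ℕ => ((e - 2 * s - i + 1) * zchoose (e - s) (i - 1) : ℂ) • B i s) Q
      rw [sum_range_succ, hB0 Q s (by lia)] at this
      rw [smul_zero, add_zero, zchoose_of_neg (e - s) (j := ((0 : ℕ) : ℤ) - 1) (by lia)] at this
      simpa using this.symm
    simp only [h2, sum_add_distrib, h3]
    rw [sum_comm (f := fun i s : ℕ => ((e - 2 * s - (i + 1 : ℕ) + 1) *
      zchoose (e - s) ((i + 1 : ℕ) - 1) : ℂ) • B (i + 1) s), sum_congr rfl fun s _ => h4 s,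
      sum_comm (s := range Q) (t := range Q) (f := fun s i : ℕ => ((e - 2 * s - i + 1) *
      zchoose (e - s) (i - 1) : ℂ) • B i s)]
    simp only [← sum_add_distrib, smul_sum, smul_smul, ← add_smul]
    refine sum_congr rfl fun i _ => sum_congr rfl fun s _ => ?_
    congr 1
    have h6 := congrArg (Int.cast : ℤ → ℂ) (zchoose_absorb (e - s) i)
    rw [zchoose_succ]
    push_cast at h6 ⊢
    linear_combination -h6

theorem eventually_dividedL_eq_zero (v : V) : ∀ᶠ s : ℕ in atTop, A.dividedL s v = 0 := by
  obtain ⟨S, hS⟩ := A.exists_dividedL_eq_zero v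
  filter_upwards [eventually_ge_atTop S] with s hs
  exact hS s (by exact_mod_cast hs)

theorem eventually_expL1 (v : V) : ∀ᶠ Q : ℕ in atTop,
    A.expL1 v = ∑ s ∈ range Q, A.dividedL s v := by
  have h : ∀ s : ℕ, A.dividedL s v = ((s.factorial : ℂ)⁻¹) • (A.L 1 ^ s) v := fun s => by
    rw [dividedL_natCast, LinearMap.smul_apply]
  simp only [h, expL1]
  refine finsum_nat_eventually_eq ?_
  simp only [← h]
  exact A.eventually_dividedL_eq_zero v

theorem expL1_add (u v : V) : A.expL1 (u + v) = A.expL1 u + A.expL1 v := by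
  obtain ⟨Q, h1, h2, h3⟩ := ((A.eventually_expL1 (u + v)).and
    ((A.eventually_expL1 u).and (A.eventually_expL1 v))).exists
  simp only [h1, h2, h3, map_add, sum_add_distrib]

theorem expL1_smul (c : ℂ) (v : V) : A.expL1 (c • v) = c • A.expL1 v := by
  obtain ⟨Q, h1, h2⟩ := ((A.eventually_expL1 (c • v)).and (A.eventually_expL1 v)).exists
  simp only [h1, h2, map_smul, smul_sum]

theorem support_negOnePowL0_finite (v : V) :
    (Function.support fun k => (-1 : ℂ) ^ k • A.component k v).Finite :=
  (A.support_component_finite v).subset fun k hk h => hk (by simp only [h, smul_zero])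

theorem negOnePowL0_add (u v : V) :
    A.negOnePowL0 (u + v) = A.negOnePowL0 u + A.negOnePowL0 v := by
  simp only [negOnePowL0, component_add, smul_add]
  exact finsum_add_distrib (A.support_negOnePowL0_finite u) (A.support_negOnePowL0_finite v)

theorem negOnePowL0_smul (c : ℂ) (v : V) : A.negOnePowL0 (c • v) = c • A.negOnePowL0 v := by
  simp only [negOnePowL0, component_smul, smul_comm _ c]
  exact (smul_finsum' c (A.support_negOnePowL0_finite v)).symm

theorem negOnePowL0_of_mem {k : ℤ} {v : V} (hv : v ∈ A.wt k) :
    A.negOnePowL0 v = (-1 : ℂ) ^ k • v := by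
  rw [negOnePowL0, finsum_eq_single _ k, A.component_of_mem hv]
  intro l hl
  rw [A.component_of_mem_ne hv hl.symm, smul_zero]

/-- `φ = e^{L(1)} (-1)^{L(0)}` as a linear map. -/
def phiLinear : V →ₗ[ℂ] V where
  toFun := A.phi
  map_add' u v := by simp only [phi, negOnePowL0_add, expL1_add]
  map_smul' c v := by simp only [phi, negOnePowL0_smul, expL1_smul, RingHom.id_apply]

theorem phiLinear_apply (v : V) : A.phiLinear v = A.phi v := rfl

theorem phiLinear_of_mem {k : ℤ} {v : V} (hv : v ∈ A.wt k) :
    A.phiLinear v = (-1 : ℂ) ^ k • A.expL1 v := by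
  rw [phiLinear_apply, phi, A.negOnePowL0_of_mem hv, expL1_smul]

theorem eventually_phiLinear {k : ℤ} {v : V} (hv : v ∈ A.wt k) : ∀ᶠ Q : ℕ in atTop,
    A.phiLinear v = (-1 : ℂ) ^ k • ∑ s ∈ range Q, A.dividedL s v := by
  filter_upwards [A.eventually_expL1 v] with Q h
  rw [A.phiLinear_of_mem hv, h]

/-- (-1)^{L(0)} turns e^{L(1)} into e^{-L(1)}, since L(1) lowers the weight by one. -/
theorem phiLinear_phiLinear (v : V) : A.phiLinear (A.phiLinear v) = v := by
  induction v using A.wt_induction with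
  | hadd u v hu hv => rw [map_add, map_add, hu, hv]
  | hwt k v hv =>
  obtain ⟨S, hS⟩ := A.exists_dividedL_eq_zero v
  have h0 : ∀ r : ℕ, A.phiLinear (A.dividedL r v) =
      (-1 : ℂ) ^ (k - r) • ∑ s ∈ range (S + 1), A.dividedL s (A.dividedL r v) := by
    intro r
    obtain ⟨Q, h1, hQ⟩ := ((A.eventually_phiLinear (A.dividedL_mem_wt hv r)).and
      (eventually_ge_atTop (S + 1))).exists
    rw [h1, ← sum_range_add_sum_Ico _ hQ, sum_eq_zero (s := Ico _ _) fun s hs => ?_, add_zero]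
    have := (mem_Ico.1 hs).1
    have h2 := hS (s + r : ℕ) (by lia)
    rw [dividedL_natCast, LinearMap.smul_apply, smul_eq_zero] at h2
    rw [dividedL_natCast, dividedL_natCast, LinearMap.smul_apply, LinearMap.smul_apply, map_smul,
      ← Module.End.mul_apply, ← pow_add,
      h2.resolve_left (inv_ne_zero (Nat.cast_ne_zero.2 (Nat.factorial_ne_zero _))), smul_zero,
      smul_zero]
  obtain ⟨Q, h1, hQ⟩ := ((A.eventually_phiLinear hv).and (eventually_ge_atTop (S + 1))).exists
  rw [h1, map_smul, ← sum_range_add_sum_Ico _ hQ, sum_eq_zero (s := Ico _ _) fun s hs => ?_,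
    add_zero, map_sum]
  swap
  · exact hS s (by have := (mem_Ico.1 hs).1; lia)
  simp only [h0, smul_sum, smul_smul]
  -- For α = e = -1 the flip identity is e^{-L(1)}e^{L(1)} = 1, the multinomial factors coming from
  -- (-1 choose r)(-1-r choose s).
  have h3 := sum_range_flip (-1) (-1) (R := S + 1) (g := fun t => (-1 : ℂ) ^ t • A.dividedL t v)
    fun t ht => by simp only [hS t (by lia), smul_zero]
  have h8 : ∑ t ∈ range (S + 1), (zchoose (-1 - -1) t : ℂ) • (-1 : ℂ) ^ t • A.dividedL t v = v := by
    rw [sum_eq_single_of_mem 0 (mem_range.2 (Nat.succ_pos _))]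
    · simp [dividedL_zero, zchoose_zero_right]
    · intro t _ ht
      rw [sub_self, zchoose_zero_left (by lia), Int.cast_zero, zero_smul]
  rw [h8] at h3
  refine Eq.trans ?_ h3
  refine sum_congr rfl fun r _ => ?_
  rw [smul_sum]
  refine sum_congr rfl fun s _ => ?_
  have h4 := zchoose_neg_one_pow (-1) r
  have h5 := zchoose_neg_one_pow (-1 - r) s
  rw [show (r : ℤ) - -1 - 1 = (r : ℕ) by ring, zchoose_natCast (r : ℤ), Ring.choose_natCast,
    Nat.choose_self] at h4
  rw [show (s : ℤ) - (-1 - r) - 1 = (r + s : ℕ) by push_cast; ring,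
    zchoose_natCast ((r + s : ℕ) : ℤ), Ring.choose_natCast] at h5
  rw [h4, h5]
  simp only [dividedL_natCast, LinearMap.smul_apply, map_smul, smul_smul]
  rw [← Module.End.mul_apply, ← pow_add, add_comm s r, ← zpow_add₀ (by norm_num)]
  congr 1
  have h6 : ((r + s).choose s : ℂ) * r.factorial * s.factorial = (r + s).factorial := by
    exact_mod_cast Nat.add_choose_mul_factorial_mul_factorial r s
  have h7 : (-1 : ℂ) ^ (k + (k - r)) = (-1) ^ r := by
    rw [show k + (k - (r : ℤ)) = 2 * (k - r) + r by ring, zpow_add₀ (by norm_num), zpow_mul]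
    simp
  rw [h7, ← h6]
  have f1 : (r.factorial : ℂ) ≠ 0 := Nat.cast_ne_zero.2 (Nat.factorial_ne_zero _)
  have f2 : (s.factorial : ℂ) ≠ 0 := Nat.cast_ne_zero.2 (Nat.factorial_ne_zero _)
  have f3 : ((r + s).choose s : ℂ) ≠ 0 :=
    Nat.cast_ne_zero.2 (Nat.choose_pos (Nat.le_add_left _ _)).ne'
  have f4 : ((-1 : ℂ) ^ s) * (-1) ^ s = 1 := by rw [← mul_pow]; simp
  have f5 : ((-1 : ℂ) ^ r) * (-1) ^ r = 1 := by rw [← mul_pow]; simp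
  push_cast
  field_simp
  rw [pow_add]
  linear_combination -f5 - (-1 : ℂ) ^ r * (-1) ^ r * f4

theorem eventually_phiLinear_mode {k : ℤ} {u : V} (hu : u ∈ A.wt k) (j : ℤ) (v : V) :
    ∀ᶠ Q : ℕ in atTop, A.phiLinear (A.mode u j v) = (-1 : ℂ) ^ (k + j + 1) •
      ∑ i ∈ range Q, ∑ s ∈ range Q, (zchoose (2 * k - j - 2 - s) i : ℂ) •
        A.mode (A.dividedL s u) (j + i) (A.phiLinear v) := by
  induction v using A.wt_induction with
  | hadd v w hv hw =>
    filter_upwards [hv, hw] with Q h1 h2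
    simp only [map_add, h1, h2, smul_add, sum_add_distrib]
  | hwt l v hv =>
  obtain ⟨S, hS⟩ := A.exists_dividedL_eq_zero u
  obtain ⟨R, hR⟩ := A.exists_dividedL_eq_zero v
  have h1 : ∀ᶠ i : ℕ in atTop, ∀ s ∈ range S, ∀ r ∈ range R,
      A.mode (A.dividedL s u) (j + i) (A.dividedL r v) = 0 := by
    rw [Finset.eventually_all]
    intro s _
    rw [Finset.eventually_all]
    intro r _
    exact A.eventually_mode_add_eq_zero _ _ j
  obtain ⟨I, hI⟩ := eventually_atTop.1 h1
  have h2 : ∀ i s : ℕ, ∀ r : ℤ, I ≤ i ∨ S ≤ s →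
      A.mode (A.dividedL s u) (j + i) (A.dividedL r v) = 0 := by
    intro i s r h
    rcases lt_or_ge r 0 with hr | hr
    · rw [A.dividedL_of_neg hr, LinearMap.zero_apply, map_zero]
    obtain ⟨r, rfl⟩ := Int.eq_ofNat_of_zero_le hr
    rcases le_or_gt S s with hs | hs
    · rw [hS s (by lia), mode_zero_left, LinearMap.zero_apply]
    rcases le_or_gt R r with hr' | hr'
    · rw [hR r (by lia), map_zero]
    exact hI i (h.resolve_right (by lia)) s (mem_range.2 hs) r (mem_range.2 hr')
  filter_upwards [A.eventually_phiLinear (A.mode_mem_wt hu hv j), A.eventually_phiLinear hv,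
    eventually_ge_atTop (I + S + R)] with Q h3 h4 hQ
  have h5 : ∀ i s : ℕ, ∑ M ∈ range Q,
      A.mode (A.dividedL s u) (j + i) (A.dividedL ((M : ℤ) - i - s) v) =
      ∑ r ∈ range Q, A.mode (A.dividedL s u) (j + i) (A.dividedL r v) := by
    intro i s
    by_cases h : I ≤ i ∨ S ≤ s
    · simp only [h2 i s _ h]
    have h6 := sum_range_add (fun M : ℕ =>
      A.mode (A.dividedL s u) (j + i) (A.dividedL ((M : ℤ) - i - s) v)) (i + s) (Q - (i + s))
    rw [Nat.add_sub_cancel' (by lia), sum_eq_zero (s := range (i + s)) fun M hM => ?_,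
      zero_add] at h6
    · rw [h6, ← sum_range_add_sum_Ico (n := Q) (m := Q - (i + s)) _ (by lia),
        sum_eq_zero (s := Ico _ _) fun r hr => ?_, add_zero]
      · refine sum_congr rfl fun r _ => ?_
        rw [show ((i + s + r : ℕ) : ℤ) - i - s = r by push_cast; ring]
      · rw [hR r (by have := (mem_Ico.1 hr).1; lia), map_zero]
    · rw [A.dividedL_of_neg (s := (M : ℤ) - i - s) (by have := mem_range.1 hM; lia),
        LinearMap.zero_apply, map_zero]
  rw [h3, h4, sum_congr rfl fun M hM => A.dividedL_mode hu j v M (mem_range.1 hM), sum_comm]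
  -- Of the sign attached to the weight k+l-j-1 of u_j v, the factor (-1)^l is absorbed into φ(v).
  rw [show k + l - j - 1 = (k + j + 1) + l + 2 * (-j - 1) by ring, zpow_add₀ (by norm_num),
    zpow_add₀ (by norm_num), zpow_mul _ 2, show (-1 : ℂ) ^ (2 : ℤ) = 1 by norm_num, one_zpow,
    mul_one, mul_smul]
  congr 1
  rw [smul_sum]
  refine sum_congr rfl fun i _ => ?_
  rw [sum_comm, smul_sum]
  refine sum_congr rfl fun s _ => ?_
  rw [← smul_sum, h5, map_smul, map_sum, smul_comm]

theorem phiLinear_mode {k : ℤ} {u : V} (hu : u ∈ A.wt k) (j : ℤ) (v : V) {Q : ℕ}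
    (hQ : ∀ i s : ℕ, Q ≤ i ∨ Q ≤ s → A.mode (A.dividedL s u) (j + i) (A.phiLinear v) = 0) :
    A.phiLinear (A.mode u j v) = (-1 : ℂ) ^ (k + j + 1) •
      ∑ i ∈ range Q, ∑ s ∈ range Q, (zchoose (2 * k - j - 2 - s) i : ℂ) •
        A.mode (A.dividedL s u) (j + i) (A.phiLinear v) := by
  obtain ⟨R, h, hR⟩ := ((A.eventually_phiLinear_mode hu j v).and (eventually_ge_atTop Q)).exists
  rw [h, ← sum_range_add_sum_Ico (n := R) _ hR, sum_eq_zero (s := Ico _ _) fun i hi => ?_, add_zero]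
  · congr 1
    refine sum_congr rfl fun i _ => ?_
    rw [← sum_range_add_sum_Ico _ hR, sum_eq_zero (s := Ico _ _) fun s hs => ?_, add_zero]
    rw [hQ i s (Or.inr (mem_Ico.1 hs).1), smul_zero]
  · refine sum_eq_zero fun s _ => ?_
    rw [hQ i s (Or.inl (mem_Ico.1 hi).1), smul_zero]

/-- The substitution z ↦ -z/(1+z) in the kernel: the new exponent of 1+z comes from the old degree
α+β at ∞. -/
theorem eventually_phiLinear_residue {k : ℤ} {u : V} (hu : u ∈ A.wt k) (α β : ℤ) (v : V) :
    ∀ᶠ Q : ℕ in atTop, A.phiLinear (A.residue (bin α β) u v) = (-1 : ℂ) ^ (k + β + 1) •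
      ∑ s ∈ range Q, A.residue (bin (2 * k - α - β - 2 - s) β) (A.dividedL s u)
        (A.phiLinear v) := by
  obtain ⟨H, hH⟩ := eventually_atTop.1 (A.eventually_mode_add_eq_zero u v β)
  obtain ⟨S, hS⟩ := A.exists_dividedL_eq_zero u
  have h1 : ∀ᶠ i : ℕ in atTop, ∀ s ∈ range S,
      A.mode (A.dividedL s u) (β + i) (A.phiLinear v) = 0 := by
    rw [Finset.eventually_all]
    intro s _
    exact A.eventually_mode_add_eq_zero _ _ β
  obtain ⟨I, hI⟩ := eventually_atTop.1 h1
  filter_upwards [eventually_ge_atTop (H + S + I)] with Q hQ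
  have h2 : ∀ i s : ℕ, Q ≤ i ∨ Q ≤ s →
      A.mode (A.dividedL s u) (β + i) (A.phiLinear v) = 0 := by
    intro i s h
    rcases le_or_gt S s with hs | hs
    · rw [hS s (by lia), mode_zero_left, LinearMap.zero_apply]
    · exact hI i (by lia) s (mem_range.2 hs)
  have h3 : ∀ h : ℕ, A.phiLinear (A.mode u (β + h) v) = (-1 : ℂ) ^ (k + β + 1) •
      (-1 : ℂ) ^ h • ∑ i ∈ range Q, ∑ s ∈ range Q, (zchoose (2 * k - β - 2 - s - h) i : ℂ) •
        A.mode (A.dividedL s u) (β + (h + i : ℕ)) (A.phiLinear v) := by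
    intro h
    rw [A.phiLinear_mode hu (β + h) v (Q := Q) fun i s his => by
      rw [add_assoc, ← Nat.cast_add]
      exact h2 (h + i) s (by lia), smul_smul, ← zpow_natCast (-1 : ℂ) h,
      ← zpow_add₀ (by norm_num)]
    congr 1
    · congr 1
      ring
    · refine sum_congr rfl fun i _ => sum_congr rfl fun s _ => ?_
      rw [show 2 * k - (β + (h : ℤ)) - 2 - s = 2 * k - β - 2 - s - h by ring, add_assoc,
        ← Nat.cast_add]
  rw [A.residue_bin_eq_sum α (H := Q) fun t ht => by
    rw [show t = β + (t - β).toNat by lia]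
    exact hH _ (by lia)]
  simp only [map_sum, map_smul, h3]
  have h4 : ∀ s : ℕ, A.residue (bin (2 * k - α - β - 2 - s) β) (A.dividedL s u) (A.phiLinear v) =
      ∑ h ∈ range Q, ((-1) ^ h * zchoose α h : ℂ) • ∑ i ∈ range Q,
        (zchoose (2 * k - β - 2 - s - h) i : ℂ) •
          A.mode (A.dividedL s u) (β + (h + i : ℕ)) (A.phiLinear v) := by
    intro s
    rw [sum_range_flip α (2 * k - β - 2 - s) (R := Q)
      (g := fun t => A.mode (A.dividedL s u) (β + t) (A.phiLinear v)) fun t ht => h2 t s (Or.inl ht),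
      A.residue_bin_eq_sum _ (H := Q) fun t ht => by
        rw [show t = β + (t - β).toNat by lia]
        exact h2 _ _ (by lia)]
    rw [show 2 * k - β - 2 - s - α = 2 * k - α - β - 2 - (s : ℤ) by ring]
  simp only [h4]
  rw [sum_comm, smul_sum]
  refine sum_congr rfl fun h _ => ?_
  rw [← smul_sum, sum_comm, smul_comm, mul_comm, mul_smul,
    smul_comm ((zchoose α h : ℤ) : ℂ) ((-1 : ℂ) ^ h)]

/-! ### φ exchanges O'_{n,m}(V) with O'_{m,n}(V) and reverses products -/

/-- Skew symmetry modulo `O'_{n,m}(V)`. -/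
theorem mkQ_mode_skew (n m : ℕ) {k l : ℤ} {u v : V} (hu : u ∈ A.wt k) (hv : v ∈ A.wt l) (j : ℤ)
    {R : ℕ} (hR : ∀ i : ℕ, R ≤ i → A.mode u (j + i) v = 0) :
    (A.O' n m).mkQ (A.mode v j u) = (-1 : ℂ) ^ (j + 1) • ∑ i ∈ range R,
      (zchoose (k + l + m - n - j - 2) i : ℂ) • (A.O' n m).mkQ (A.mode u (j + i) v) := by
  obtain ⟨H, h, hH⟩ := ((A.eventually_skew_symmetry u v j).and (eventually_ge_atTop R)).exists
  rw [h, ← sum_range_add_sum_Ico _ hH, sum_eq_zero (s := Ico _ _) fun i hi => ?_, add_zero,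
    map_smul, map_sum]
  swap
  · rw [hR i (mem_Ico.1 hi).1, mode_zero_left, LinearMap.zero_apply, smul_zero]
  congr 1
  refine sum_congr rfl fun i _ => ?_
  have h1 := zchoose_neg_one_pow (-1) i
  rw [show (i : ℤ) - -1 - 1 = (i : ℕ) by ring, zchoose_natCast (i : ℤ), Ring.choose_natCast,
    Nat.choose_self, zchoose_natCast] at h1
  -- In skew symmetry the factor e^{zL(-1)} is a power of 1+z modulo O'.
  rw [h1, ← Int.cast_smul_eq_zsmul ℂ, map_smul, A.mkQ_mode_vacuum n m (A.mode_mem_wt hu hv _),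
    smul_smul, zchoose_neg_one_pow (k + l + m - n - j - 2)]
  rw [show (n : ℤ) - m - (k + l - (j + i) - 1) = i - (k + l + m - n - j - 2) - 1 by ring,
    show -1 - (-1 - (i : ℤ)) = i by ring]
  push_cast
  rw [mul_one]

theorem mkQ_residue_skew (n m : ℕ) {k l : ℤ} {u v : V} (hu : u ∈ A.wt k) (hv : v ∈ A.wt l)
    (α β : ℤ) : (A.O' n m).mkQ (A.residue (bin α β) v u) = (-1 : ℂ) ^ (β + 1) •
      (A.O' n m).mkQ (A.residue (bin (k + l + m - n - α - β - 2) β) u v) := by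
  obtain ⟨R, hR⟩ := eventually_atTop.1 ((A.eventually_mode_add_eq_zero u v β).and
    (A.eventually_mode_add_eq_zero v u β))
  have h1 := fun i hi => (hR i hi).1
  have h2 := fun i hi => (hR i hi).2
  have h3 : ∀ h : ℕ, (A.O' n m).mkQ (A.mode v (β + h) u) = (-1 : ℂ) ^ (β + 1) • (-1 : ℂ) ^ h •
      ∑ i ∈ range R, (zchoose (k + l + m - n - β - 2 - h) i : ℂ) •
        (A.O' n m).mkQ (A.mode u (β + (h + i : ℕ)) v) := by
    intro h
    rw [A.mkQ_mode_skew n m hu hv (β + h) (R := R) fun i hi => by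
      rw [add_assoc, ← Nat.cast_add]
      exact h1 _ (by lia), smul_smul, ← zpow_natCast (-1 : ℂ) h, ← zpow_add₀ (by norm_num)]
    congr 1
    · congr 1
      ring
    · refine sum_congr rfl fun i _ => ?_
      rw [show k + l + m - n - (β + (h : ℤ)) - 2 = k + l + m - n - β - 2 - h by ring,
        add_assoc β, ← Nat.cast_add]
  rw [A.residue_bin_eq_sum α (H := R) fun t ht => by
      rw [show t = β + (t - β).toNat by lia]
      exact h2 _ (by lia),
    A.residue_bin_eq_sum _ (H := R) fun t ht => by
      rw [show t = β + (t - β).toNat by lia]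
      exact h1 _ (by lia)]
  have h4 := sum_range_flip α (k + l + m - n - β - 2) (R := R)
    (g := fun t => (A.O' n m).mkQ (A.mode u (β + t) v)) fun t ht => by rw [h1 t ht, map_zero]
  simp only [map_sum, map_smul, h3]
  rw [show k + l + m - n - α - β - 2 = k + l + m - n - β - 2 - α by ring, ← h4, smul_sum]
  refine sum_congr rfl fun h _ => ?_
  rw [smul_comm, mul_comm, mul_smul]

/-- L(1)L(-2)𝟏 = 3L(-1)𝟏 = 0; there is no central term. So e^{L(1)} fixes ω. -/
theorem L_one_omega : A.L 1 A.omega = 0 := by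
  have h := A.virasoro 1 (-2) A.vacuum
  have h0 : ∀ k : ℤ, 0 ≤ k → modeOf A.Y A.omega k A.vacuum = 0 :=
    A.mode_vacuum_nonneg A.omega
  norm_num at h
  rw [h0 2 (by norm_num), h0 0 le_rfl, A.mode_vacuum_neg_one] at h
  simpa [L_one_eq, mode] using h

/-- The kernel 1+z is carried to itself when the weight is 2, with sign (-1)^3. The new relation
thus has m-n replaced by n-m. -/
theorem phiLinear_L_neg_one_add_L_zero (v : V) :
    A.phiLinear (A.L (-1) v + A.L 0 v) =
      -(A.L (-1) (A.phiLinear v) + A.L 0 (A.phiLinear v)) := by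
  rw [L_neg_one_add_L_zero, L_neg_one_add_L_zero]
  obtain ⟨Q, h, hQ⟩ := ((A.eventually_phiLinear_residue A.omega_mem 1 0 v).and
    (eventually_gt_atTop 0)).exists
  rw [h, sum_eq_single_of_mem 0 (mem_range.2 hQ)]
  · rw [Nat.cast_zero, dividedL_zero]
    norm_num
  · intro s _ hs
    obtain ⟨s, rfl⟩ := Nat.exists_eq_succ_of_ne_zero hs
    rw [dividedL_natCast, pow_succ, LinearMap.smul_apply, Module.End.mul_apply, L_one_omega]
    simp

theorem phiLinear_mem_O' {n m : ℕ} {v : V} (hv : v ∈ A.O' n m) : A.phiLinear v ∈ A.O' m n := by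
  suffices A.O' n m ≤ (A.O' m n).comap A.phiLinear from this hv
  refine Submodule.span_le.2 ?_
  rintro _ (⟨k, u, hu, v, rfl⟩ | ⟨u, rfl⟩)
  · obtain ⟨Q, h⟩ :=
      (A.eventually_phiLinear_residue hu (k + m) (-((n : ℤ) + m + 2)) v).exists
    rw [SetLike.mem_coe, Submodule.mem_comap, ← neg_neg ((n : ℤ) + m + 2), ← residue_bin, h]
    refine Submodule.smul_mem _ _ (Submodule.sum_mem _ fun s _ =>
      A.residue_mem_O' (A.dividedL_mem_wt hu s) (bin_mem_polarSpace (by lia) (by lia)) _)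
  · rw [SetLike.mem_coe, Submodule.mem_comap, ← add_assoc, map_add, map_smul,
      phiLinear_L_neg_one_add_L_zero]
    have : A.L (-1) (A.phiLinear u) + (A.L 0 (A.phiLinear u) +
        ((n : ℂ) - m) • A.phiLinear u) ∈ A.O' m n :=
      Submodule.subset_span (Or.inr ⟨_, rfl⟩)
    rw [← neg_mem_iff]
    convert this using 1
    module

/-- Applying φ on the left and skew symmetry on the right performs the same substitution, so both
sides become the same double sum over the components of φ(u) and φ(v). The truncation coefficients
agree because m and n enter them symmetrically. -/
theorem mkQ_phiLinear_star (m p n : ℕ) (u v : V) :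
    (A.O' m n).mkQ (A.phiLinear (A.star m p n u v)) =
      (A.O' m n).mkQ (A.star n p m (A.phiLinear v) (A.phiLinear u)) := by
  induction u using A.wt_induction with
  | hadd u v hu hv => simp only [map_add, LinearMap.add_apply, hu, hv]
  | hwt k u hu =>
  induction v using A.wt_induction with
  | hadd u v hu hv => simp only [map_add, LinearMap.add_apply, hu, hv]
  | hwt l v hv =>
  have h1 : ∀ᶠ Q : ℕ in atTop, ∀ i ∈ range (p + 1),
      A.phiLinear (A.residue (bin (k + m) ((p : ℤ) - n - m - 1 - i)) u v) =
      (-1 : ℂ) ^ (k + ((p : ℤ) - n - m - 1 - i) + 1) • ∑ s ∈ range Q,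
        A.residue (bin (2 * k - (k + m) - ((p : ℤ) - n - m - 1 - i) - 2 - s)
          ((p : ℤ) - n - m - 1 - i)) (A.dividedL s u) (A.phiLinear v) := by
    rw [Finset.eventually_all]
    intro i _
    exact A.eventually_phiLinear_residue hu _ _ v
  obtain ⟨Q, h1, hQu, hQv⟩ :=
    (h1.and ((A.eventually_phiLinear hu).and (A.eventually_phiLinear hv))).exists
  rw [A.star_of_mem_wt _ _ _ hu, starFun]
  simp only [binTrunc, mul_sum, mul_smul_comm, bin_mul_bin, zero_add, add_zero, map_sum, map_smul,
    LinearMap.sum_apply, LinearMap.smul_apply]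
  rw [sum_congr rfl fun i hi => by rw [h1 i hi]]
  rw [hQu, hQv]
  simp only [map_sum, map_smul, LinearMap.sum_apply, LinearMap.smul_apply,
    A.star_of_mem_wt n p m (A.dividedL_mem_wt hv _), starFun, binTrunc, mul_sum, mul_smul_comm,
    bin_mul_bin, zero_add, add_zero,
    A.mkQ_residue_skew m n (A.dividedL_mem_wt hu _) (A.dividedL_mem_wt hv _), smul_sum, smul_smul]
  rw [sum_comm]
  refine sum_congr rfl fun s _ => ?_
  rw [sum_comm]
  refine sum_congr rfl fun r _ => sum_congr rfl fun i _ => ?_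
  rw [show (p : ℤ) - m - n - 1 - i = p - n - m - 1 - i by ring,
    show (p : ℤ) - m - n - 1 = p - n - m - 1 by ring,
    show k - (s : ℤ) + (l - r) + n - m - (l - r + n) - (p - n - m - 1 - i) - 2 =
      2 * k - (k + m) - (p - n - m - 1 - i) - 2 - s by ring,
    add_assoc k, zpow_add₀ (by norm_num : (-1 : ℂ) ≠ 0) k]
  congr 1
  ring

/-! ### The algebras, the bimodule and the map induced by φ -/

/-- The bilinear map induced on quotients by a bilinear map. -/
def quotientMap₂ (P Q R : Submodule ℂ V) (f : V →ₗ[ℂ] V →ₗ[ℂ] V)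
    (hP : ∀ u ∈ P, ∀ v, f u v ∈ R) (hQ : ∀ u, ∀ v ∈ Q, f u v ∈ R) :
    V ⧸ P →ₗ[ℂ] V ⧸ Q →ₗ[ℂ] V ⧸ R :=
  P.liftQ (Q.liftQ (f.compr₂ R.mkQ).flip fun v hv => by
    ext u
    exact (Submodule.Quotient.mk_eq_zero R).2 (hQ u v hv)).flip fun u hu => by
      ext v
      exact (Submodule.Quotient.mk_eq_zero R).2 (hP u hu v)

theorem toABimod_eq {n m : ℕ} {u v : V} (h : u - v ∈ A.O' n m) :
    A.toABimod n m u = A.toABimod n m v :=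
  (Submodule.Quotient.eq _).2 (by rwa [O_eq_O'])

theorem toAAlg_eq {n : ℕ} {u v : V} (h : u - v ∈ A.O' n n) : A.toAAlg n u = A.toAAlg n v :=
  (Submodule.Quotient.eq _).2 h

/-- The product on `A_k(V)`. -/
def algMul (k : ℕ) : V ⧸ A.O' k k →ₗ[ℂ] V ⧸ A.O' k k →ₗ[ℂ] V ⧸ A.O' k k :=
  quotientMap₂ _ _ _ (A.star k k k) (fun _ hu v => A.star_mem_O'_of_left_mem k k k hu v)
    fun u _ hv => A.star_mem_O'_of_right_mem k k k u hv

/-- The left action of `A_n(V)` on `A_{n,m}(V)`. -/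
def leftAction (n m : ℕ) : V ⧸ A.O' n n →ₗ[ℂ] A.ABimod n m →ₗ[ℂ] A.ABimod n m :=
  quotientMap₂ _ _ _ (A.star m n n)
    (fun _ hu v => by rw [O_eq_O']; exact A.star_mem_O'_of_left_mem m n n hu v)
    fun u _ hv => by rw [O_eq_O'] at hv ⊢; exact A.star_mem_O'_of_right_mem m n n u hv

/-- The right action of `A_m(V)` on `A_{n,m}(V)`. -/
def rightAction (n m : ℕ) : A.ABimod n m →ₗ[ℂ] V ⧸ A.O' m m →ₗ[ℂ] A.ABimod n m :=
  quotientMap₂ _ _ _ (A.star m m n)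
    (fun _ hu v => by rw [O_eq_O'] at hu ⊢; exact A.star_mem_O'_of_left_mem m m n hu v)
    fun u _ hv => by rw [O_eq_O']; exact A.star_mem_O'_of_right_mem m m n u hv

/-- The ring structure on `A_k(V)`. -/
abbrev ringAAlg (k : ℕ) : Ring (A.AAlg k) :=
  letI : AddCommGroup (A.AAlg k) := inferInstanceAs (AddCommGroup (V ⧸ A.O' k k))
  { (inferInstance : AddCommGroup (A.AAlg k)) with
    mul := fun a b => A.algMul k a b
    one := A.toAAlg k A.vacuum
    left_distrib := fun a b c => map_add (A.algMul k a) b c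
    right_distrib := fun a b c => LinearMap.map_add₂ (A.algMul k) a b c
    zero_mul := fun a => LinearMap.map_zero₂ (A.algMul k) a
    mul_zero := fun a => map_zero (A.algMul k a)
    mul_assoc := by
      rintro ⟨a⟩ ⟨b⟩ ⟨c⟩
      exact A.toAAlg_eq (A.star_assoc_mem_O' k k k k a b c)
    one_mul := by
      rintro ⟨a⟩
      exact congrArg (A.toAAlg k) (A.star_vacuum_left k k a)
    mul_one := by
      rintro ⟨a⟩
      exact A.toAAlg_eq (A.star_vacuum_right_sub_mem_O' k k a) }

/-- The algebra structure on `A_k(V)`. -/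
abbrev algebraAAlg (k : ℕ) : @Algebra ℂ (A.AAlg k) _ (A.ringAAlg k).toSemiring :=
  letI := A.ringAAlg k
  letI : Module ℂ (A.AAlg k) := inferInstanceAs (Module ℂ (V ⧸ A.O' k k))
  Algebra.ofModule (fun c a b => LinearMap.map_smul₂ (A.algMul k) c a b)
    fun c a b => map_smul (A.algMul k a) c b

theorem isAAlg (k : ℕ) : @IsAAlg V _ _ A k (A.ringAAlg k) (A.algebraAAlg k) :=
  letI := A.ringAAlg k
  letI := A.algebraAAlg k
  { isLinearMap := ⟨fun _ _ => rfl, fun _ _ => rfl⟩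
    mul := fun _ _ => rfl
    one := rfl }

/-- The left `A_n(V)`-module structure on `A_{n,m}(V)`. -/
abbrev leftModule (n m : ℕ) :
    @Module (A.AAlg n) (A.ABimod n m) (A.ringAAlg n).toSemiring _ :=
  letI := A.ringAAlg n
  { smul := fun a x => A.leftAction n m a x
    one_smul := by
      rintro ⟨x⟩
      exact congrArg (A.toABimod n m) (A.star_vacuum_left m n x)
    mul_smul := by
      rintro ⟨a⟩ ⟨b⟩ ⟨x⟩
      exact A.toABimod_eq (A.star_assoc_mem_O' n m n n a b x)
    smul_zero := fun a => map_zero (A.leftAction n m a)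
    smul_add := fun a x y => map_add (A.leftAction n m a) x y
    add_smul := fun a b x => LinearMap.map_add₂ (A.leftAction n m) a b x
    zero_smul := fun x => LinearMap.map_zero₂ (A.leftAction n m) x }

/-- The right `A_m(V)`-module structure on `A_{n,m}(V)`. -/
abbrev rightModule (n m : ℕ) : @Module (A.AAlg m)ᵐᵒᵖ (A.ABimod n m)
    (@MulOpposite.instSemiring _ (A.ringAAlg m).toSemiring) _ :=
  letI := A.ringAAlg m
  { smul := fun b x => A.rightAction n m x b.unop
    one_smul := by
      rintro ⟨x⟩
      exact A.toABimod_eq (A.star_vacuum_right_sub_mem_O' m n x)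
    mul_smul := by
      rintro ⟨⟨a⟩⟩ ⟨⟨b⟩⟩ ⟨x⟩
      exact (A.toABimod_eq (A.star_assoc_mem_O' n m m m x b a)).symm
    smul_zero := fun b => LinearMap.map_zero₂ (A.rightAction n m) b.unop
    smul_add := fun b x y => LinearMap.map_add₂ (A.rightAction n m) x y b.unop
    add_smul := fun a b x => map_add (A.rightAction n m x) a.unop b.unop
    zero_smul := fun x => map_zero (A.rightAction n m x) }

/-- The map `A_{n,m}(V) → A_{m,n}(V)` induced by `φ`. -/
def phiMap (n m : ℕ) : A.ABimod n m →ₗ[ℂ] A.ABimod m n :=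
  Submodule.mapQ _ _ A.phiLinear fun v hv => by
    rw [O_eq_O'] at hv
    rw [Submodule.mem_comap, O_eq_O']
    exact A.phiLinear_mem_O' hv

theorem phiMap_comp_phiMap (n m : ℕ) : A.phiMap n m ∘ₗ A.phiMap m n = LinearMap.id := by
  ext v
  exact congrArg (A.toABimod m n) (A.phiLinear_phiLinear v)

/-- The isomorphism `A_{n,m}(V) ≃ A_{m,n}(V)` induced by `φ`. -/
def phiEquiv (n m : ℕ) : A.ABimod n m ≃ₗ[ℂ] A.ABimod m n :=
  LinearEquiv.ofLinearMap (A.phiMap n m) (A.phiMap m n) (A.phiMap_comp_phiMap n m)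
    (A.phiMap_comp_phiMap m n)

theorem toABimod_phiLinear_star (m p n : ℕ) (u v : V) :
    A.toABimod m n (A.phiLinear (A.star m p n u v)) =
      A.toABimod m n (A.star n p m (A.phiLinear v) (A.phiLinear u)) :=
  A.toABimod_eq ((Submodule.Quotient.eq _).1 (A.mkQ_phiLinear_star m p n u v))

end VertexOperatorAlgebra

/-! ### Transport along φ and conclusion -/

/-- Transport of a module structure along an additive equivalence. -/
abbrev AddEquiv.transportModule {R M N : Type*} [Semiring R] [AddCommMonoid M] [AddCommMonoid N]
    [Module R M] (e : M ≃+ N) : Module R N :=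
  letI : SMul R N := ⟨fun a y => e (a • e.symm y)⟩
  Function.Injective.module R e.symm.toAddMonoidHom e.symm.injective
    fun a y => e.symm_apply_apply (a • e.symm y)

/-- Transport of a bimodule structure along a linear equivalence. -/
theorem IsBimodule.transport {R S M N : Type*} [Ring R] [Algebra ℂ R] [Ring S] [Algebra ℂ S]
    [AddCommGroup M] [Module ℂ M] [Module R M] [Module Sᵐᵒᵖ M] [AddCommGroup N] [Module ℂ N]
    (h : IsBimodule R S M) (e : M ≃ₗ[ℂ] N) :
    @IsBimodule R S N _ _ _ _ _ _ e.toAddEquiv.transportModule e.toAddEquiv.transportModule := by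
  obtain ⟨h1, h2, h3⟩ := h
  let _ : Module R N := e.toAddEquiv.transportModule
  let _ : Module Sᵐᵒᵖ N := e.toAddEquiv.transportModule
  refine ⟨⟨fun a b y => ?_⟩, ⟨fun c a y => ?_⟩, ⟨fun c b y => ?_⟩⟩
  · change e (a • e.symm (e (b • e.symm y))) = e (b • e.symm (e (a • e.symm y)))
    rw [e.symm_apply_apply, e.symm_apply_apply, smul_comm]
  · change e ((c • a) • e.symm y) = c • e (a • e.symm y)
    rw [smul_assoc, map_smul]
  · change e ((c • b) • e.symm y) = c • e (b • e.symm y)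
    rw [smul_assoc, map_smul]

namespace VertexOperatorAlgebra

variable {V : Type*} [AddCommGroup V] [Module ℂ V] (A : VertexOperatorAlgebra V)

theorem isBimodule (n m : ℕ) :
    @IsBimodule (A.AAlg n) (A.AAlg m) (A.ABimod n m) (A.ringAAlg n) (A.algebraAAlg n)
      (A.ringAAlg m) (A.algebraAAlg m) _ _ (A.leftModule n m) (A.rightModule n m) := by
  let _ := A.ringAAlg
  let _ := A.algebraAAlg
  let _ := A.leftModule n m
  let _ := A.rightModule n m
  refine ⟨⟨?_⟩, ⟨fun c a x => ?_⟩, ⟨fun c b x => ?_⟩⟩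
  · rintro ⟨a⟩ ⟨⟨b⟩⟩ ⟨x⟩
    exact (A.toABimod_eq (A.star_assoc_mem_O' n m n m a x b)).symm
  · exact LinearMap.map_smul₂ (A.leftAction n m) c a x
  · exact map_smul (A.rightAction n m x) c b.unop

end VertexOperatorAlgebra

end

theorem mainTheorem5 {V : Type*} [AddCommGroup V] [Module ℂ V] (A : VertexOperatorAlgebra V)
    (n m : ℕ) :
    -- the algebras `A_n(V)` and `A_m(V)`
    ∃ (_ : ∀ k, Ring (A.AAlg k)) (_ : ∀ k, Algebra ℂ (A.AAlg k))
      -- the left and right actions on `A_{n,m}(V)`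
      (_ : Module (A.AAlg n) (A.ABimod n m)) (_ : Module (A.AAlg m)ᵐᵒᵖ (A.ABimod n m))
      -- the twisted left and right actions on `A_{m,n}(V)`
      (_ : Module (A.AAlg n) (A.ABimod m n)) (_ : Module (A.AAlg m)ᵐᵒᵖ (A.ABimod m n))
      -- the isomorphism
      (Φ : A.ABimod n m ≃ₗ[ℂ] A.ABimod m n),
      (∀ k, A.IsAAlg k) ∧
      (IsBimodule (A.AAlg n) (A.AAlg m) (A.ABimod n m) ∧
        (∀ u v : V, A.toAAlg n u • A.toABimod n m v = A.toABimod n m (A.starLeft m n u v)) ∧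
        (∀ u v : V, MulOpposite.op (A.toAAlg m v) • A.toABimod n m u =
          A.toABimod n m (A.starRight m n u v))) ∧
      (IsBimodule (A.AAlg n) (A.AAlg m) (A.ABimod m n) ∧
        (∀ u v : V, A.toAAlg n u • A.toABimod m n v =
          A.toABimod m n (A.starRight n m v (A.phi u))) ∧
        (∀ u v : V, MulOpposite.op (A.toAAlg m v) • A.toABimod m n u =
          A.toABimod m n (A.starLeft n m (A.phi v) u))) ∧
      (∀ v : V, Φ (A.toABimod n m v) = A.toABimod m n (A.phi v)) ∧
      (∀ (a : A.AAlg n) (x : A.ABimod n m), Φ (a • x) = a • Φ x) ∧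
      (∀ (b : A.AAlg m) (x : A.ABimod n m),
        Φ (MulOpposite.op b • x) = MulOpposite.op b • Φ x) := by

  let _ := A.ringAAlg
  let _ := A.algebraAAlg
  let _ := A.leftModule n m
  let _ := A.rightModule n m
  let _ : Module (A.AAlg n) (A.ABimod m n) := (A.phiEquiv n m).toAddEquiv.transportModule
  let _ : Module (A.AAlg m)ᵐᵒᵖ (A.ABimod m n) := (A.phiEquiv n m).toAddEquiv.transportModule
  -- With the twisted actions defined by transport, the bimodule axioms and the equivariance of φ
  -- are formal; only the explicit formulas for these actions need an argument.
  refine ⟨A.ringAAlg, A.algebraAAlg, A.leftModule n m, A.rightModule n m,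
    (A.phiEquiv n m).toAddEquiv.transportModule, (A.phiEquiv n m).toAddEquiv.transportModule,
    A.phiEquiv n m, A.isAAlg, ⟨A.isBimodule n m, fun _ _ => rfl, fun _ _ => rfl⟩,
    ⟨(A.isBimodule n m).transport _, fun u v => ?_, fun u v => ?_⟩, fun _ => rfl,
    fun a x => ?_, fun b x => ?_⟩
  -- The transported action of u sends v to φ(u · φ⁻¹(v)), and φ⁻¹ = φ.
  · change A.toABimod m n (A.phiLinear (A.star m n n u (A.phiLinear v))) =
      A.toABimod m n (A.star n n m v (A.phiLinear u))
    rw [A.toABimod_phiLinear_star, A.phiLinear_phiLinear]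
  · change A.toABimod m n (A.phiLinear (A.star m m n (A.phiLinear u) v)) =
      A.toABimod m n (A.star n m m (A.phiLinear v) u)
    rw [A.toABimod_phiLinear_star, A.phiLinear_phiLinear]
  · change A.phiEquiv n m (a • x) = A.phiEquiv n m (a • (A.phiEquiv n m).symm (A.phiEquiv n m x))
    rw [LinearEquiv.symm_apply_apply]
  · change A.phiEquiv n m (MulOpposite.op b • x) =
      A.phiEquiv n m (MulOpposite.op b • (A.phiEquiv n m).symm (A.phiEquiv n m x))
    rw [LinearEquiv.symm_apply_apply]
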